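/- **Setting.** Let $\mathcal F:\ \emptyset=K_0\leftrightarrow K_1\leftrightarrow\cdots\leftrightarrow K_m$ be a simplex-wise zigzag filtration: each $K_i$ is a finite abstract simplicial complex, and each arrow is either a forward inclusion $K_i\hookrightarrow K_{i+1}$ that adds exactly one simplex or a backward inclusion $K_i\hookleftarrow K_{i+1}$ that deletes exactly one simplex. All chains have $\mathbb Z_2$ coefficients and are regarded as chains of the total complex $\bigcup_i K_i$. Let $\mathsf Z(K_i)$, $\mathsf B(K_i)$ and $\mathsf H(K_i)=\mathsf Z(K_i)/\mathsf B(K_i)$ be the cycle, boundary and homology groups over all degrees. The homology zigzag module $\mathsf H(\mathcal F)$ consists of the spaces $\mathsf H(K_i)$ with the maps $\psi_i^*$ induced by the inclusions, and the boundary zigzag module $\mathsf B(\mathcal F)$ consists of the spaces $\mathsf B(K_i)$ with the inclusions $\psi^\#_i$. The barcode of a zigzag module is the multiset of intervals $[b,d]\subseteq\{0,\dots,m\}$ in a decomposition of it into interval modules; $\mathsf{Pers}^H(\mathcal F)$ and $\mathsf{Pers}^B(\mathcal F)$ denote the barcodes of $\mathsf H(\mathcal F)$ and $\mathsf B(\mathcal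 F)$. *Birth and death indices.* For $0\le j<m$: if $\psi^*_j$ is forward, then $j+1\in\mathsf P^H$ if $\psi_j^*$ is injective, and $j\in\mathsf N^H$ otherwise; if $\psi^*_j$ is backward, then $j+1\in \mathsf P^H$ if $\psi^*_j$ is surjective, and $j\in\mathsf N^H$ otherwise. If $\psi^\#_j$ is forward and not surjective, then $j+1\in\mathsf P^B$; if it is backward and not surjective, then $j\in\mathsf N^B$. Finally, $\dim\mathsf H(K_m)$ copies of $m$ are added to the multiset $\mathsf N^H$ and $\dim\mathsf B(K_m)$ copies of $m$ to the multiset $\mathsf N^B$. *Representatives.* A homology representative for $[b,d]$, where $b\in\mathsf P^H$ and $d\in\mathsf N^H$, is a sequence of cycles $z_\alpha\in\mathsf Z(K_\alpha)$, $\alpha\in[b,d]$, all of the same degree $p$, such that for $b\le\alpha<d$ the map $\psi^*_\alpha$ matches $[z_\alpha]$ and $[z_{\alpha+1}]$ (in its direction), and such that: if $\psi^*_{b-1}$ is forward, then $z_b\notin\mathsf Z(K_{b-1})$, and if it is backward, then $[z_b]$ is a nonzero element of $\ker\psi^*_{b-1}$; if $d<m$ and $\psi^*_d$ is backward, then $z_d\notin\mathsf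 Z(K_{d+1})$, and if $d<m$ and $\psi^*_d$ is forward, then $[z_d]$ is a nonzero element of $\ker\psi^*_d$. A boundary representative for $[b,d]$, where $b\in\mathsf P^B$ and $d\in\mathsf N^B$, is a sequence of boundaries $z_\alpha\in\mathsf B(K_\alpha)$, $\alpha\in[b,d]$, all of the same degree $p$, with $z_{\alpha+1}=z_\alpha$ for $b\le\alpha<d$, $z_b\notin\mathsf B(K_{b-1})$, and $z_d\notin\mathsf B(K_{d+1})$ if $d<m$. *Wires.* A wire at an index $\iota\in\mathsf P^H\cup\mathsf P^B$ is a cycle $w_\iota\in\mathsf Z(K_\iota)$ such that (i) $K_{\iota-1}\hookrightarrow K_\iota$ is forward and $w_\iota\notin\mathsf Z(K_{\iota-1})$, or (ii) $K_{\iota-1}\hookleftarrow K_\iota$ is backward and $w_\iota\in\mathsf B(K_{\iota-1})\setminus\mathsf B(K_\iota)$, or (iii) $K_{\iota-1}\hookrightarrow K_\iota$ is forward and $w_\iota\in\mathsf B(K_\iota)\setminus\mathsf B(K_{\iota-1})$. **Theorem.** For every simplex-wise zigzag filtration $\mathcal F$ there is a single family of wires $W=\{w_\iota\mid\iota\in\mathsf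 P^H\cup\mathsf P^B\}$, one at each birth index, such that for every $[b,d]\in\mathsf{Pers}^H(\mathcal F)$ (respectively $[b,d]\in\mathsf{Pers}^B(\mathcal F)$) there is a set of indices $J\subseteq\mathsf P^H\cup\mathsf P^B$ for which the chains $$z_\alpha=\sum_{\iota\in J,\ \iota\le\alpha}w_\iota,\qquad \alpha\in[b,d],$$ form a homology (respectively boundary) representative for $[b,d]$. Moreover, the barcodes $\mathsf{Pers}^H(\mathcal F)$ and $\mathsf{Pers}^B(\mathcal F)$ exist and are unique, and each of them pairs births with deaths: the left endpoints of the intervals in $\mathsf{Pers}^H(\mathcal F)$ are the elements of $\mathsf P^H$, each occurring exactly once, and the right endpoints form the multiset $\mathsf N^H$; likewise for $\mathsf{Pers}^B(\mathcal F)$ with $\mathsf P^B$ and $\mathsf N^B$. -/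

import Mathlib

noncomputable section

namespace WireZigzag

/-! Simplicial chains with coefficients in the field with two elements.  A (not necessarily full)
abstract simplicial complex on a vertex type `V` is Mathlib's `PreAbstractSimplicialComplex V`: a
set of nonempty finite subsets of `V`, closed under passing to nonempty subsets. -/

/-- Chains over `ℤ/2` on all finite subsets of `V`; the chains of each complex, and those of the
total complex of a filtration, form subspaces of this space. -/
abbrev Chain (V : Type*) := Finset V →₀ ZMod 2

/-- The boundary operator: a simplex is sent to the sum of its nonempty faces of codimension one
(so the boundary of a vertex is `0`). -/
def boundaryMap (V : Type*) : Chain V →ₗ[ZMod 2] Chain V :=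
  Finsupp.linearCombination (ZMod 2) fun σ : Finset V =>
    ∑ τ ∈ (σ.powersetCard (σ.card - 1)).filter (fun τ => τ.Nonempty), Finsupp.single τ (1 : ZMod 2)

/-- The chains of dimension `p`, that is, the sums of simplices with `p + 1` vertices. -/
def chainsOfDim (V : Type*) (p : ℕ) : Submodule (ZMod 2) (Chain V) :=
  Finsupp.supported (ZMod 2) (ZMod 2) {σ : Finset V | σ.card = p + 1}

section Complex

variable {V : Type*}

/-- The chain group `C(K)`, over all degrees. -/
def chainGroup (K : PreAbstractSimplicialComplex V) : Submodule (ZMod 2) (Chain V) :=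
  Finsupp.supported (ZMod 2) (ZMod 2) K.faces

/-- The cycle group `Z(K)`, over all degrees. -/
def cycleGroup (K : PreAbstractSimplicialComplex V) : Submodule (ZMod 2) (Chain V) :=
  chainGroup K ⊓ LinearMap.ker (boundaryMap V)

/-- The boundary group `B(K)`, over all degrees. -/
def boundaryGroup (K : PreAbstractSimplicialComplex V) : Submodule (ZMod 2) (Chain V) :=
  (chainGroup K).map (boundaryMap V)

/-- The boundaries of `K`, as a subspace of `Z(K)`.  (The additive structure of `Z(K)` is spelled
out to help instance search; it is the usual one.) -/
def boundariesInCycles (K : PreAbstractSimplicialComplex V) :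
    @Submodule (ZMod 2) (cycleGroup K) _ AddCommGroup.toAddCommMonoid _ :=
  (boundaryGroup K).submoduleOf (cycleGroup K)

/-- The homology group `H(K) = Z(K) / B(K)`, over all degrees. -/
abbrev Homology (K : PreAbstractSimplicialComplex V) :=
  cycleGroup K ⧸ boundariesInCycles K

/-- The homology class of a cycle. -/
def homologyClass (K : PreAbstractSimplicialComplex V) (z : Chain V) (hz : z ∈ cycleGroup K) :
    Homology K :=
  Submodule.Quotient.mk (⟨z, hz⟩ : cycleGroup K)

theorem chainGroup_mono {K L : PreAbstractSimplicialComplex V} (h : K.faces ⊆ L.faces) :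
    chainGroup K ≤ chainGroup L :=
  Finsupp.supported_mono h

theorem cycleGroup_mono {K L : PreAbstractSimplicialComplex V} (h : K.faces ⊆ L.faces) :
    cycleGroup K ≤ cycleGroup L :=
  inf_le_inf_right _ (chainGroup_mono h)

theorem boundaryGroup_mono {K L : PreAbstractSimplicialComplex V} (h : K.faces ⊆ L.faces) :
    boundaryGroup K ≤ boundaryGroup L :=
  Submodule.map_mono (chainGroup_mono h)

/-- The map `H(K) → H(L)` induced by an inclusion of complexes. -/
def homologyMap {K L : PreAbstractSimplicialComplex V} (h : K.faces ⊆ L.faces) :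
    Homology K →ₗ[ZMod 2] Homology L :=
  Submodule.mapQ _ _ (Submodule.inclusion (cycleGroup_mono h))
    (fun _ hx => boundaryGroup_mono h hx)

/-- The inclusion `B(K) → B(L)` induced by an inclusion of complexes. -/
def boundaryInclusion {K L : PreAbstractSimplicialComplex V} (h : K.faces ⊆ L.faces) :
    boundaryGroup K →ₗ[ZMod 2] boundaryGroup L :=
  Submodule.inclusion (boundaryGroup_mono h)

/-- `L` arises from `K` by the addition of a single simplex. -/
def AddsSimplex (K L : PreAbstractSimplicialComplex V) : Prop :=
  ∃ σ : Finset V, σ ∉ K.faces ∧ L.faces = insert σ K.faces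

end Complex

/-! Zigzag modules and their barcodes. -/

/-- A zigzag module of length `m` over `ℤ/2`: spaces `X 0, …, X m` and, for each `i < m`, a linear
map `X i → X (i+1)` if `fwd i` holds and a linear map `X (i+1) → X i` otherwise.  Spaces with an
index above `m` play no role. -/
structure ZigzagModule (m : ℕ) (fwd : ℕ → Prop) where
  X : ℕ → Type*
  [instAddCommGroup : ∀ i, AddCommGroup (X i)]
  [instModule : ∀ i, Module (ZMod 2) (X i)]
  forward : ∀ i, i < m → fwd i → (X i →ₗ[ZMod 2] X (i + 1))
  backward : ∀ i, i < m → ¬ fwd i → (X (i + 1) →ₗ[ZMod 2] X i)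

attribute [instance] ZigzagModule.instAddCommGroup ZigzagModule.instModule

namespace ZigzagModule

variable {m : ℕ} {fwd : ℕ → Prop}

/-- An isomorphism of zigzag modules. -/
structure Iso (M N : ZigzagModule m fwd) where
  equiv : ∀ i, i ≤ m → (M.X i ≃ₗ[ZMod 2] N.X i)
  comm_forward : ∀ (i : ℕ) (hi : i < m) (hf : fwd i) (x : M.X i),
    equiv (i + 1) hi (M.forward i hi hf x) = N.forward i hi hf (equiv i hi.le x)
  comm_backward : ∀ (i : ℕ) (hi : i < m) (hf : ¬ fwd i) (x : M.X (i + 1)),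
    equiv i hi.le (M.backward i hi hf x) = N.backward i hi hf (equiv (i + 1) hi x)

/-- The direct sum of a finite family of zigzag modules (finite direct sums of vector spaces are
finite products). -/
def directSum {n : ℕ} (M : Fin n → ZigzagModule m fwd) : ZigzagModule m fwd where
  X i := ∀ k, (M k).X i
  forward i hi hf := LinearMap.pi fun k => (M k).forward i hi hf ∘ₗ LinearMap.proj k
  backward i hi hf := LinearMap.pi fun k => (M k).backward i hi hf ∘ₗ LinearMap.proj k

/-- The space at index `i` of the interval module over `[b,d]`: the field itself if `i ∈ [b,d]`,
and `0` otherwise. -/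
def intervalSpace (b d i : ℕ) : Submodule (ZMod 2) (ZMod 2) :=
  if b ≤ i ∧ i ≤ d then ⊤ else ⊥

/-- The map between the spaces of the interval module at the indices `i` and `j`: the identity if
both indices lie in `[b,d]`, and `0` otherwise. -/
def intervalMap (b d i j : ℕ) : intervalSpace b d i →ₗ[ZMod 2] intervalSpace b d j :=
  if h : b ≤ j ∧ j ≤ d then
    Submodule.inclusion (le_top.trans_eq (show ⊤ = intervalSpace b d j from (if_pos h).symm))
  else 0

/-- The interval module over `[b,d]`. -/
def intervalModule (m : ℕ) (fwd : ℕ → Prop) (b d : ℕ) : ZigzagModule m fwd where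
  X i := intervalSpace b d i
  forward i _ _ := intervalMap b d i (i + 1)
  backward i _ _ := intervalMap b d (i + 1) i

/-- `S` is the multiset of intervals `[b,d] ⊆ {0, …, m}` (encoded as pairs `(b, d)`) of a
decomposition of `M` into interval modules. -/
def IsBarcode (M : ZigzagModule m fwd) (S : Multiset (ℕ × ℕ)) : Prop :=
  ∃ (n : ℕ) (I : Fin n → ℕ × ℕ),
    Finset.univ.val.map I = S ∧
    (∀ k, (I k).1 ≤ (I k).2 ∧ (I k).2 ≤ m) ∧
    Nonempty (Iso M (directSum fun k => intervalModule m fwd (I k).1 (I k).2))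

end ZigzagModule

/-! Simplex-wise zigzag filtrations. -/

/-- A simplex-wise zigzag filtration `∅ = K 0 ↔ K 1 ↔ ⋯ ↔ K m`: each arrow is the addition or the
deletion of one simplex.  Complexes with an index above `m` play no role. -/
structure Filtration (V : Type*) (m : ℕ) where
  K : ℕ → PreAbstractSimplicialComplex V
  empty : (K 0).faces = ∅
  step : ∀ i, i < m → AddsSimplex (K i) (K (i + 1)) ∨ AddsSimplex (K (i + 1)) (K i)

namespace Filtration

variable {V : Type*} {m : ℕ} (F : Filtration V m)

/-- The arrow between `K i` and `K (i+1)` is a forward inclusion. -/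
def Forward (i : ℕ) : Prop := (F.K i).faces ⊆ (F.K (i + 1)).faces

theorem subset_of_not_forward {i : ℕ} (hi : i < m) (h : ¬ F.Forward i) :
    (F.K (i + 1)).faces ⊆ (F.K i).faces := by
  rcases F.step i hi with ⟨σ, _, hσ⟩ | ⟨σ, _, hσ⟩
  · exact absurd (show (F.K i).faces ⊆ (F.K (i + 1)).faces from hσ ▸ Set.subset_insert _ _) h
  · exact hσ ▸ Set.subset_insert _ _

/-- The homology zigzag module `H(F)`. -/
def homologyModule : ZigzagModule m F.Forward where
  X i := Homology (F.K i)
  forward _ _ hf := homologyMap hf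
  backward _ hi hf := homologyMap (F.subset_of_not_forward hi hf)

/-- The boundary zigzag module `B(F)`. -/
def boundaryModule : ZigzagModule m F.Forward where
  X i := boundaryGroup (F.K i)
  forward _ _ hf := boundaryInclusion hf
  backward _ hi hf := boundaryInclusion (F.subset_of_not_forward hi hf)

open Classical in
/-- The homology birth indices `P^H(F)`: the indices `j + 1` such that the homology map at `j` is
forward and injective, or backward and surjective. -/
def homologyBirths : Finset ℕ :=
  ((Finset.range m).filter fun j => ∃ hj : j < m,
    (∃ hf : F.Forward j, Function.Injective (F.homologyModule.forward j hj hf)) ∨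
    (∃ hf : ¬ F.Forward j, Function.Surjective (F.homologyModule.backward j hj hf))).image
      fun j => j + 1

open Classical in
/-- The multiset `N^H(F)` of homology death indices: the indices `j < m` such that the homology map
at `j` is forward and not injective, or backward and not surjective, and `dim H(K m)` copies of
`m`. -/
def homologyDeaths : Multiset ℕ :=
  ((Finset.range m).filter fun j => ∃ hj : j < m,
    (∃ hf : F.Forward j, ¬ Function.Injective (F.homologyModule.forward j hj hf)) ∨
    (∃ hf : ¬ F.Forward j, ¬ Function.Surjective (F.homologyModule.backward j hj hf))).val +
  Multiset.replicate (Module.finrank (ZMod 2) (Homology (F.K m))) m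

open Classical in
/-- The boundary birth indices `P^B(F)`: the indices `j + 1` such that the inclusion of boundary
groups at `j` is forward and not surjective. -/
def boundaryBirths : Finset ℕ :=
  ((Finset.range m).filter fun j => ∃ hj : j < m, ∃ hf : F.Forward j,
    ¬ Function.Surjective (F.boundaryModule.forward j hj hf)).image fun j => j + 1

open Classical in
/-- The multiset `N^B(F)` of boundary death indices: the indices `j < m` such that the inclusion of
boundary groups at `j` is backward and not surjective, and `dim B(K m)` copies of `m`. -/
def boundaryDeaths : Multiset ℕ :=
  ((Finset.range m).filter fun j => ∃ hj : j < m, ∃ hf : ¬ F.Forward j,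
    ¬ Function.Surjective (F.boundaryModule.backward j hj hf)).val +
  Multiset.replicate (Module.finrank (ZMod 2) (boundaryGroup (F.K m))) m

/-- The cycles `z α`, `α ∈ [b,d]`, form a homology representative for the interval `[b,d]`.
Values of `z` outside `[b,d]` play no role. -/
structure IsHomologyRep (b d : ℕ) (z : ℕ → Chain V) : Prop where
  birth_mem : b ∈ F.homologyBirths
  death_mem : d ∈ F.homologyDeaths
  birth_le_death : b ≤ d
  death_le : d ≤ m
  cycle : ∀ α, b ≤ α → α ≤ d → z α ∈ cycleGroup (F.K α)
  homogeneous : ∃ p, ∀ α, b ≤ α → α ≤ d → z α ∈ chainsOfDim V p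
  compat_forward : ∀ (α : ℕ) (hb : b ≤ α) (hd : α < d) (hf : F.Forward α),
    F.homologyModule.forward α (hd.trans_le death_le) hf
        (homologyClass (F.K α) (z α) (cycle α hb hd.le)) =
      homologyClass (F.K (α + 1)) (z (α + 1)) (cycle (α + 1) (Nat.le_succ_of_le hb) hd)
  compat_backward : ∀ (α : ℕ) (hb : b ≤ α) (hd : α < d) (hf : ¬ F.Forward α),
    F.homologyModule.backward α (hd.trans_le death_le) hf
        (homologyClass (F.K (α + 1)) (z (α + 1)) (cycle (α + 1) (Nat.le_succ_of_le hb) hd)) =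
      homologyClass (F.K α) (z α) (cycle α hb hd.le)
  birth_forward : ∀ j, j + 1 = b → F.Forward j → z b ∉ cycleGroup (F.K j)
  birth_backward : ∀ (j : ℕ) (hj : j + 1 = b) (hf : ¬ F.Forward j),
    homologyClass (F.K (j + 1)) (z (j + 1)) (cycle (j + 1) hj.ge (hj.trans_le birth_le_death)) ≠ 0 ∧
    F.homologyModule.backward j (hj.trans_le (birth_le_death.trans death_le)) hf
      (homologyClass (F.K (j + 1)) (z (j + 1))
        (cycle (j + 1) hj.ge (hj.trans_le birth_le_death))) = 0
  death_backward : d < m → ¬ F.Forward d → z d ∉ cycleGroup (F.K (d + 1))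
  death_forward : ∀ (hd : d < m) (hf : F.Forward d),
    homologyClass (F.K d) (z d) (cycle d birth_le_death le_rfl) ≠ 0 ∧
    F.homologyModule.forward d hd hf
      (homologyClass (F.K d) (z d) (cycle d birth_le_death le_rfl)) = 0

/-- The cycles `z α`, `α ∈ [b,d]`, form a boundary representative for the interval `[b,d]`.
Values of `z` outside `[b,d]` play no role. -/
structure IsBoundaryRep (b d : ℕ) (z : ℕ → Chain V) : Prop where
  birth_mem : b ∈ F.boundaryBirths
  death_mem : d ∈ F.boundaryDeaths
  birth_le_death : b ≤ d
  death_le : d ≤ m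
  boundary : ∀ α, b ≤ α → α ≤ d → z α ∈ boundaryGroup (F.K α)
  homogeneous : ∃ p, ∀ α, b ≤ α → α ≤ d → z α ∈ chainsOfDim V p
  compat : ∀ α, b ≤ α → α < d → z (α + 1) = z α
  birth : ∀ j, j + 1 = b → z b ∉ boundaryGroup (F.K j)
  death : d < m → z d ∉ boundaryGroup (F.K (d + 1))

/-- `z` is a wire with starting index `i`. -/
def IsWire (i : ℕ) (z : Chain V) : Prop :=
  i ∈ F.homologyBirths ∪ F.boundaryBirths ∧ z ∈ cycleGroup (F.K i) ∧
  ∃ j, j + 1 = i ∧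
    ((F.Forward j ∧ z ∉ cycleGroup (F.K j)) ∨
     (¬ F.Forward j ∧ z ∈ boundaryGroup (F.K j) ∧ z ∉ boundaryGroup (F.K i)) ∨
     (F.Forward j ∧ z ∈ boundaryGroup (F.K i) ∧ z ∉ boundaryGroup (F.K j)))

end Filtration

/-- The sequence of chains generated by the wires `w j`, `j ∈ J`: at index `α` it is the sum of the
`w j` with `j ∈ J` and `j ≤ α`. -/
def bundleSum {V : Type*} (w : ℕ → Chain V) (J : Finset ℕ) (α : ℕ) : Chain V :=
  ∑ j ∈ J.filter (fun j => j ≤ α), w j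

end WireZigzag

end

/-! ### Uniqueness of barcodes. -/

noncomputable section

namespace WireZigzag

namespace ZigzagModule

variable {m : ℕ} {fwd : ℕ → Prop}

/-! Adding or deleting a simplex `σ` changes exactly one of the groups `Z` and `B`, and by one
dimension: if `∂σ` already bounds in the smaller complex, only `Z` changes, otherwise only `B`
(`Adds.boundaryGroup_le_iff`, `Adds.cycleGroup_le`). Hence homology and boundary births occur at
different arrows, and one wire per birth index serves both modules. Both are zigzags of quotients `Z
i / B i`, with pairs `(Z(K), B(K))` and `(B(K), 0)`; `PairZigzag` treats them together.

A bar `[b,d]` carries a bundle of wires. Wires that enter after `b` come from backward births, so at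
their arrow they lie in the larger boundary group and do not disturb the homology class. Bundles add
by symmetric difference. The sum of two bars still represents the bar born at `b` if the other one,
born at `b₀`, is smaller in a suitable total order of the births (`key`); this is `IsBar.add`.

Bars are built arrow by arrow (`IsState.exists_succ`). A birth opens a bar with a single wire. At a
forward death some combination of open bars becomes a boundary, and the bar of largest key in it
absorbs the others and ends. At a backward death some open cycles are lost; the one of smallest key
ends and is added to the others, which repairs them because the codimension is one. Degrees are
respected since each death happens in a single degree.

At every index the chains of the open bars represent a basis of `Z / B` (`IsState.isBasisMod`), and
the structure maps send each basis vector to its successor or to zero, so the bars give an interval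
decomposition. It is unique because the number of bars containing a given interval is an isomorphism
invariant (`Iso.card_le`), and these numbers determine the multiset (`multiset_eq_of_countP_eq`). -/

theorem Iso.symm_comm_forward {M N : ZigzagModule m fwd} (f : Iso M N) (i : ℕ) (hi : i < m)
    (hf : fwd i) (y : N.X i) :
    (f.equiv (i + 1) hi).symm (N.forward i hi hf y) =
      M.forward i hi hf ((f.equiv i hi.le).symm y) := by
  rw [LinearEquiv.symm_apply_eq, f.comm_forward, LinearEquiv.apply_symm_apply]

theorem Iso.symm_comm_backward {M N : ZigzagModule m fwd} (f : Iso M N) (i : ℕ) (hi : i < m)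
    (hf : ¬ fwd i) (y : N.X (i + 1)) :
    (f.equiv i hi.le).symm (N.backward i hi hf y) =
      M.backward i hi hf ((f.equiv (i + 1) hi).symm y) := by
  rw [LinearEquiv.symm_apply_eq, f.comm_backward, LinearEquiv.apply_symm_apply]

/-- The inverse of an isomorphism of zigzag modules. -/
def Iso.symm {M N : ZigzagModule m fwd} (f : Iso M N) : Iso N M where
  equiv i hi := (f.equiv i hi).symm
  comm_forward := f.symm_comm_forward
  comm_backward := f.symm_comm_backward

/-- The composition of isomorphisms of zigzag modules. -/
def Iso.trans {M N O : ZigzagModule m fwd} (f : Iso M N) (g : Iso N O) : Iso M O where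
  equiv i hi := (f.equiv i hi).trans (g.equiv i hi)
  comm_forward i hi hf x := by simp [f.comm_forward, g.comm_forward]
  comm_backward i hi hf x := by simp [f.comm_backward, g.comm_backward]

theorem intervalSpace_of_mem {b d i : ℕ} (h : b ≤ i ∧ i ≤ d) : intervalSpace b d i = ⊤ :=
  if_pos h

theorem intervalSpace_of_notMem {b d i : ℕ} (h : ¬ (b ≤ i ∧ i ≤ d)) : intervalSpace b d i = ⊥ :=
  if_neg h

theorem intervalSpace_eq_zero {b d i : ℕ} (h : ¬ (b ≤ i ∧ i ≤ d)) (x : intervalSpace b d i) :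
    x = 0 := by
  have hx : (x : ZMod 2) ∈ (⊥ : Submodule (ZMod 2) (ZMod 2)) :=
    (intervalSpace_of_notMem h).le x.2
  exact Subtype.ext ((Submodule.mem_bot _).1 hx)

theorem coe_intervalMap {b d i j : ℕ} (h : b ≤ j ∧ j ≤ d) (x : intervalSpace b d i) :
    (intervalMap b d i j x : ZMod 2) = x := by
  simp [intervalMap, h]

/-- The generator of the interval module over `[b,d]` at the index `i`. -/
def intervalUnit (b d i : ℕ) : intervalSpace b d i :=
  if h : b ≤ i ∧ i ≤ d then ⟨1, by rw [intervalSpace_of_mem h]; trivial⟩ else 0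

theorem coe_intervalUnit {b d i : ℕ} (h : b ≤ i ∧ i ≤ d) :
    (intervalUnit b d i : ZMod 2) = 1 := by
  simp [intervalUnit, h]

theorem intervalMap_unit {b d i j : ℕ} (hi : b ≤ i ∧ i ≤ d) (hj : b ≤ j ∧ j ≤ d) :
    intervalMap b d i j (intervalUnit b d i) = intervalUnit b d j :=
  Subtype.ext (by rw [coe_intervalMap hj, coe_intervalUnit hi, coe_intervalUnit hj])

theorem eq_smul_intervalUnit {b d i : ℕ} (x : intervalSpace b d i) :
    x = (x : ZMod 2) • intervalUnit b d i := by
  by_cases h : b ≤ i ∧ i ≤ d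
  · exact Subtype.ext (by simp [coe_intervalUnit h])
  · rw [intervalSpace_eq_zero h x]; simp

section Uniqueness

variable {n n' : ℕ} {I : Fin n → ℕ × ℕ} {I' : Fin n' → ℕ × ℕ}

/-- The direct sum of the interval modules over a finite family of intervals. -/
abbrev intervalSum (m : ℕ) (fwd : ℕ → Prop) (I : Fin n → ℕ × ℕ) : ZigzagModule m fwd :=
  directSum fun k => intervalModule m fwd (I k).1 (I k).2

theorem intervalSum_forward_single (i : ℕ) (hi : i < m) (hf : fwd i) (l : Fin n)
    (x : intervalSpace (I l).1 (I l).2 i) :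
    (intervalSum m fwd I).forward i hi hf (Pi.single l x : ∀ k, intervalSpace (I k).1 (I k).2 i) =
      (Pi.single l (intervalMap _ _ _ _ x) : ∀ k, intervalSpace (I k).1 (I k).2 (i + 1)) := by
  funext k
  change intervalMap _ _ _ _ ((Pi.single l x : ∀ k, intervalSpace (I k).1 (I k).2 i) k) = _
  by_cases h : k = l
  · subst h; simp
  · simp [h]

theorem intervalSum_backward_single (i : ℕ) (hi : i < m) (hf : ¬ fwd i) (l : Fin n)
    (x : intervalSpace (I l).1 (I l).2 (i + 1)) :
    (intervalSum m fwd I).backward i hi hf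
      (Pi.single l x : ∀ k, intervalSpace (I k).1 (I k).2 (i + 1)) =
      (Pi.single l (intervalMap _ _ _ _ x) : ∀ k, intervalSpace (I k).1 (I k).2 i) := by
  funext k
  change intervalMap _ _ _ _ ((Pi.single l x : ∀ k, intervalSpace (I k).1 (I k).2 (i + 1)) k) = _
  by_cases h : k = l
  · subst h; simp
  · simp [h]

/-- The matrix entries of an isomorphism between direct sums of interval modules. -/
def Iso.entry (f : Iso (intervalSum m fwd I) (intervalSum m fwd I')) (i : ℕ) (hi : i ≤ m)
    (k : Fin n) (l : Fin n') : intervalSpace (I' l).1 (I' l).2 i :=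
  (f.equiv i hi (Pi.single k (intervalUnit (I k).1 (I k).2 i) :
    ∀ k, intervalSpace (I k).1 (I k).2 i) :
      ∀ l, intervalSpace (I' l).1 (I' l).2 i) l

/-- The contribution of the summand `l` of the target to the entry `(k, k')` of the composition of
an isomorphism between direct sums of interval modules with its inverse. -/
def Iso.roundTrip (f : Iso (intervalSum m fwd I) (intervalSum m fwd I')) (i : ℕ) (hi : i ≤ m)
    (k k' : Fin n) (l : Fin n') : intervalSpace (I k').1 (I k').2 i :=
  ((f.equiv i hi).symm (Pi.single l (f.entry i hi k l) :
    ∀ l, intervalSpace (I' l).1 (I' l).2 i) : ∀ k, intervalSpace (I k).1 (I k).2 i) k'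

theorem Iso.coe_roundTrip (f : Iso (intervalSum m fwd I) (intervalSum m fwd I')) (i : ℕ)
    (hi : i ≤ m) (k k' : Fin n) (l : Fin n') :
    (f.roundTrip i hi k k' l : ZMod 2) =
      (f.entry i hi k l : ZMod 2) * (f.symm.entry i hi l k' : ZMod 2) := by
  have h : (Pi.single l (f.entry i hi k l) : ∀ l, intervalSpace (I' l).1 (I' l).2 i) =
      (f.entry i hi k l : ZMod 2) • (Pi.single l (intervalUnit (I' l).1 (I' l).2 i) :
        ∀ l, intervalSpace (I' l).1 (I' l).2 i) := by
    rw [← Pi.single_smul, ← eq_smul_intervalUnit]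
  have h2 := (f.equiv i hi).symm.map_smul (f.entry i hi k l : ZMod 2)
    (Pi.single l (intervalUnit (I' l).1 (I' l).2 i) : ∀ l, intervalSpace (I' l).1 (I' l).2 i)
  rw [Iso.roundTrip, h]
  exact congrArg (fun y : ∀ k, intervalSpace (I k).1 (I k).2 i => (y k' : ZMod 2)) h2

theorem Iso.sum_roundTrip (f : Iso (intervalSum m fwd I) (intervalSum m fwd I')) (i : ℕ)
    (hi : i ≤ m) (k k' : Fin n) :
    ∑ l, f.roundTrip i hi k k' l = (Pi.single k (intervalUnit (I k).1 (I k).2 i) :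
      ∀ k, intervalSpace (I k).1 (I k).2 i) k' := by
  set x : ∀ k, intervalSpace (I k).1 (I k).2 i := Pi.single k (intervalUnit (I k).1 (I k).2 i)
  have h : ∑ l, (Pi.single l (f.entry i hi k l) : ∀ l, intervalSpace (I' l).1 (I' l).2 i) =
      f.equiv i hi x := Finset.univ_sum_single _
  have h2 := map_sum (f.equiv i hi).symm
    (fun l => (Pi.single l (f.entry i hi k l) : ∀ l, intervalSpace (I' l).1 (I' l).2 i))
    Finset.univ
  have h3 : (f.equiv i hi).symm (f.equiv i hi x) = x := LinearEquiv.symm_apply_apply _ _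
  have h4 := h2.symm.trans ((congrArg _ h).trans h3)
  have h5 := congrFun h4 k'
  rw [← h5]
  exact (Finset.sum_apply (M := fun k => intervalSpace (I k).1 (I k).2 i) k' _ _).symm

/-- Both legs of the trip from `k` through `l` to `k'` commute with the structure maps, and these
are identities on the summands `k` and `k'`. Nothing is required of `l`: it may even be zero at one
of the two indices, which then forces the contribution to vanish at both. -/
theorem Iso.coe_roundTrip_succ (f : Iso (intervalSum m fwd I) (intervalSum m fwd I')) {i : ℕ}
    (hi : i < m) {k k' : Fin n} (hk : (I k).1 ≤ i ∧ i + 1 ≤ (I k).2)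
    (hk' : (I k').1 ≤ i ∧ i + 1 ≤ (I k').2) (l : Fin n') :
    (f.roundTrip (i + 1) hi k k' l : ZMod 2) = f.roundTrip i hi.le k k' l := by
  by_cases hf : fwd i
  · have h1 : intervalMap _ _ _ (i + 1) (f.entry i hi.le k l) = f.entry (i + 1) hi k l := by
      have h := f.comm_forward i hi hf (Pi.single k (intervalUnit _ _ _) :
        ∀ k, intervalSpace (I k).1 (I k).2 i)
      replace h := (congrArg (f.equiv (i + 1) hi)
        (intervalSum_forward_single i hi hf k _)).symm.trans h
      rw [intervalMap_unit ⟨hk.1, by omega⟩ ⟨by omega, hk.2⟩] at h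
      exact (congrFun h l).symm
    have h2 := f.symm_comm_forward i hi hf (Pi.single l (f.entry i hi.le k l) :
      ∀ l, intervalSpace (I' l).1 (I' l).2 i)
    replace h2 := (congrArg (f.equiv (i + 1) hi).symm
      (intervalSum_forward_single i hi hf l _)).symm.trans h2
    rw [h1] at h2
    have h3 : f.roundTrip (i + 1) hi k k' l =
      intervalMap _ _ _ _ (f.roundTrip i hi.le k k' l) := congrFun h2 k'
    rw [h3, coe_intervalMap ⟨by omega, hk'.2⟩]
  · have h1 : intervalMap _ _ _ i (f.entry (i + 1) hi k l) = f.entry i hi.le k l := by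
      have h := f.comm_backward i hi hf (Pi.single k (intervalUnit _ _ _) :
        ∀ k, intervalSpace (I k).1 (I k).2 (i + 1))
      replace h := (congrArg (f.equiv i hi.le)
        (intervalSum_backward_single i hi hf k _)).symm.trans h
      rw [intervalMap_unit ⟨by omega, hk.2⟩ ⟨hk.1, by omega⟩] at h
      exact (congrFun h l).symm
    have h2 := f.symm_comm_backward i hi hf (Pi.single l (f.entry (i + 1) hi k l) :
      ∀ l, intervalSpace (I' l).1 (I' l).2 (i + 1))
    replace h2 := (congrArg (f.equiv i hi.le).symm
      (intervalSum_backward_single i hi hf l _)).symm.trans h2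
    rw [h1] at h2
    have h3 : f.roundTrip i hi.le k k' l =
      intervalMap _ _ _ _ (f.roundTrip (i + 1) hi k k' l) := congrFun h2 k'
    rw [h3, coe_intervalMap ⟨hk'.1, by omega⟩]

theorem Iso.coe_roundTrip_eq (f : Iso (intervalSum m fwd I) (intervalSum m fwd I')) {b d : ℕ}
    (hd : d ≤ m) {k k' : Fin n} (hk : (I k).1 ≤ b ∧ d ≤ (I k).2)
    (hk' : (I k').1 ≤ b ∧ d ≤ (I k').2) (l : Fin n') (i : ℕ) (hbi : b ≤ i) (hid : i ≤ d) :
    (f.roundTrip i (hid.trans hd) k k' l : ZMod 2) =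
      f.roundTrip b ((hbi.trans hid).trans hd) k k' l := by
  induction i, hbi using Nat.le_induction with
  | base => rfl
  | succ i hbi ih =>
    rw [f.coe_roundTrip_succ (by omega) ⟨by omega, by omega⟩ ⟨by omega, by omega⟩, ih (by omega)]

/-- The blocks of `f` and its inverse between the summands whose intervals contain `[b,d]` compose
to the identity, and rank gives the inequality. Discarding the other summands `l` is harmless: such
an `l` misses `b` or `d`, so its round trip vanishes there, and round trips are constant along
`[b,d]`. -/
theorem Iso.card_le (f : Iso (intervalSum m fwd I) (intervalSum m fwd I')) {b d : ℕ}
    (hbd : b ≤ d) (hd : d ≤ m) :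
    Fintype.card {k // (I k).1 ≤ b ∧ d ≤ (I k).2} ≤
      Fintype.card {l // (I' l).1 ≤ b ∧ d ≤ (I' l).2} := by
  have hb := hbd.trans hd
  let P : Matrix {l // (I' l).1 ≤ b ∧ d ≤ (I' l).2} {k // (I k).1 ≤ b ∧ d ≤ (I k).2} (ZMod 2) :=
    Matrix.of fun l k => (f.entry b hb k l : ZMod 2)
  let Q : Matrix {k // (I k).1 ≤ b ∧ d ≤ (I k).2} {l // (I' l).1 ≤ b ∧ d ≤ (I' l).2} (ZMod 2) :=
    Matrix.of fun k l => (f.symm.entry b hb l k : ZMod 2)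
  have hQP : Q * P = 1 := by
    ext k' k
    have hz : ∀ l : Fin n', ¬ ((I' l).1 ≤ b ∧ d ≤ (I' l).2) →
        (f.roundTrip b hb k k' l : ZMod 2) = 0 := by
      intro l hl
      obtain ⟨i, hbi, hid, hi⟩ : ∃ i, b ≤ i ∧ i ≤ d ∧ ¬ ((I' l).1 ≤ i ∧ i ≤ (I' l).2) := by
        by_cases h : (I' l).1 ≤ b
        · exact ⟨d, hbd, le_rfl, by omega⟩
        · exact ⟨b, le_rfl, hbd, by omega⟩
      rw [← f.coe_roundTrip_eq hd k.2 k'.2 l i hbi hid, f.coe_roundTrip,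
        intervalSpace_eq_zero hi (f.entry i _ k l)]
      simp
    have hs := congrArg (fun x : intervalSpace (I k').1 (I k').2 b => (x : ZMod 2))
      (f.sum_roundTrip b hb k k')
    simp only [AddSubmonoidClass.coe_finsetSum] at hs
    have hsum : ∑ l : {l // (I' l).1 ≤ b ∧ d ≤ (I' l).2}, (f.roundTrip b hb k k' l : ZMod 2) =
        ∑ l, (f.roundTrip b hb k k' l : ZMod 2) := by
      rw [← Finset.sum_subtype (Finset.univ.filter fun l => (I' l).1 ≤ b ∧ d ≤ (I' l).2)
        (by simp) fun l => (f.roundTrip b hb k k' l : ZMod 2)]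
      exact Finset.sum_filter_of_ne fun l _ h => not_imp_comm.1 (hz l) h
    rw [Matrix.mul_apply, Matrix.one_apply]
    simp only [P, Q, Matrix.of_apply]
    simp only [f.coe_roundTrip] at hsum hs
    simp only [mul_comm (f.symm.entry b hb _ _ : ZMod 2)]
    rw [hsum, hs]
    by_cases h : k' = k
    · subst h
      simp [coe_intervalUnit (show (I k').1 ≤ b ∧ b ≤ (I k').2 from ⟨k'.2.1, hbd.trans k'.2.2⟩)]
    · rw [if_neg h, Pi.single_eq_of_ne (fun h' => h (Subtype.ext h'))]
      rfl
  have h1 := Matrix.rank_mul_le_left Q P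
  rw [hQP, Matrix.rank_one] at h1
  exact h1.trans Q.rank_le_card_width

end Uniqueness

/-- A longest interval `J` of `S` lies inside some `L` in `T`, which in turn lies inside some `N` in
`S`; maximality of the length forces `L = J`. Removing `J` from both sides preserves the equality of
counts. -/
theorem multiset_eq_of_countP_eq : ∀ (S T : Multiset (ℕ × ℕ)),
    (∀ I ∈ S, I.1 ≤ I.2) → (∀ I ∈ T, I.1 ≤ I.2) →
    (∀ J ∈ S + T, S.countP (fun I => I.1 ≤ J.1 ∧ J.2 ≤ I.2) =
      T.countP (fun I => I.1 ≤ J.1 ∧ J.2 ≤ I.2)) → S = T := by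
  intro S
  induction hn : S.card generalizing S with
  | zero =>
    intro T _ _ h
    rw [Multiset.card_eq_zero] at hn
    subst hn
    refine (Multiset.eq_zero_of_forall_notMem fun J hJ => ?_).symm
    have := h J (by simpa using hJ)
    rw [Multiset.countP_zero, eq_comm, Multiset.countP_eq_zero] at this
    exact this J hJ ⟨le_rfl, le_rfl⟩
  | succ n ih =>
    intro T hS hT h
    have hne : S.toFinset.Nonempty := by
      rw [Multiset.toFinset_nonempty]
      rintro rfl
      simp at hn
    obtain ⟨J, hJ, hmax⟩ := S.toFinset.exists_max_image (fun I => I.2 - I.1) hne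
    rw [Multiset.mem_toFinset] at hJ
    have hJT : J ∈ T := by
      have h1 := h J (by simp [hJ])
      have h2 : 0 < S.countP (fun I => I.1 ≤ J.1 ∧ J.2 ≤ I.2) :=
        Multiset.countP_pos.2 ⟨J, hJ, le_rfl, le_rfl⟩
      rw [h1, Multiset.countP_pos] at h2
      obtain ⟨L, hL, hL1, hL2⟩ := h2
      have h3 := h L (by simp [hL])
      have h4 : 0 < T.countP (fun I => I.1 ≤ L.1 ∧ L.2 ≤ I.2) :=
        Multiset.countP_pos.2 ⟨L, hL, le_rfl, le_rfl⟩
      rw [← h3, Multiset.countP_pos] at h4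
      obtain ⟨N, hN, hN1, hN2⟩ := h4
      have h5 := hmax N (by simpa using hN)
      have h6 := hS J hJ
      have : L = J := Prod.ext (by omega) (by omega)
      exact this ▸ hL
    obtain ⟨S, rfl⟩ := Multiset.exists_cons_of_mem hJ
    obtain ⟨T, rfl⟩ := Multiset.exists_cons_of_mem hJT
    congr 1
    refine ih S (by simpa using hn) T (fun I hI => hS I (by simp [hI]))
      (fun I hI => hT I (by simp [hI])) fun L hL => ?_
    have := h L (by
      rw [Multiset.mem_add] at hL ⊢
      exact hL.imp (Multiset.mem_cons_of_mem) (Multiset.mem_cons_of_mem))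
    rw [Multiset.countP_cons, Multiset.countP_cons] at this
    omega

/-- The barcode of a zigzag module is unique. -/
theorem IsBarcode.unique {M : ZigzagModule m fwd} {S T : Multiset (ℕ × ℕ)} (hS : M.IsBarcode S)
    (hT : M.IsBarcode T) : S = T := by
  obtain ⟨n, I, rfl, hI, ⟨e⟩⟩ := hS
  obtain ⟨n', I', rfl, hI', ⟨e'⟩⟩ := hT
  have hc : ∀ {n : ℕ} (I : Fin n → ℕ × ℕ) (J : ℕ × ℕ),
      (Finset.univ.val.map I).countP (fun L => L.1 ≤ J.1 ∧ J.2 ≤ L.2) =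
        Fintype.card {k // (I k).1 ≤ J.1 ∧ J.2 ≤ (I k).2} := by
    intro n I J
    rw [Multiset.countP_map, Fintype.card_subtype]
    rfl
  refine multiset_eq_of_countP_eq _ _ (by simpa using fun k => (hI k).1)
    (by simpa using fun k => (hI' k).1) fun J hJ => ?_
  have hJ' : J.1 ≤ J.2 ∧ J.2 ≤ m := by
    rw [Multiset.mem_add, Multiset.mem_map, Multiset.mem_map] at hJ
    rcases hJ with ⟨k, -, rfl⟩ | ⟨k, -, rfl⟩
    · exact hI k
    · exact hI' k
  rw [hc, hc]
  exact le_antisymm ((e.symm.trans e').card_le hJ'.1 hJ'.2)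
    ((e'.symm.trans e).card_le hJ'.1 hJ'.2)

end ZigzagModule

end WireZigzag

end

/-! ### Sums of wire bundles, and bases of quotients under one-dimensional changes. -/

noncomputable section

namespace WireZigzag

section Bundles

variable {V : Type*}

/-- In characteristic two the common indices cancel. This makes addition of representatives an
operation on index sets. -/
theorem sum_symmDiff (f : ℕ → Chain V) (J J' : Finset ℕ) :
    ∑ j ∈ symmDiff J J', f j = ∑ j ∈ J, f j + ∑ j ∈ J', f j := by
  have h1 := Finset.sum_inter_add_sum_sdiff J J' f
  have h2 := Finset.sum_inter_add_sum_sdiff J' J f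
  rw [Finset.inter_comm] at h2
  rw [symmDiff, Finset.sup_eq_union, Finset.sum_union disjoint_sdiff_sdiff, ← h1, ← h2,
    add_add_add_comm, ZModModule.add_self, zero_add]

theorem bundleSum_symmDiff (w : ℕ → Chain V) (J J' : Finset ℕ) (α : ℕ) :
    bundleSum w (symmDiff J J') α = bundleSum w J α + bundleSum w J' α := by
  rw [bundleSum, bundleSum, bundleSum, ← sum_symmDiff]
  congr 1
  ext j
  simp only [Finset.mem_filter, Finset.mem_symmDiff]
  tauto

theorem bundleSum_succ (w : ℕ → Chain V) (J : Finset ℕ) (α : ℕ) :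
    bundleSum w J (α + 1) = bundleSum w J α + if α + 1 ∈ J then w (α + 1) else 0 := by
  rw [bundleSum, bundleSum]
  split_ifs with h
  · have : J.filter (fun j => j ≤ α + 1) = insert (α + 1) (J.filter fun j => j ≤ α) := by
      ext j
      simp only [Finset.mem_filter, Finset.mem_insert]
      constructor
      · rintro ⟨h1, h2⟩
        by_cases h3 : j = α + 1
        · exact Or.inl h3
        · exact Or.inr ⟨h1, by omega⟩
      · rintro (rfl | ⟨h1, h2⟩)
        · exact ⟨h, le_rfl⟩
        · exact ⟨h1, by omega⟩
    rw [this, Finset.sum_insert (by simp), add_comm]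
  · rw [add_zero]
    congr 1
    ext j
    simp only [Finset.mem_filter]
    refine and_congr_right fun h1 => ⟨fun h2 => ?_, fun h2 => by omega⟩
    have : j ≠ α + 1 := fun h3 => h (h3 ▸ h1)
    omega

theorem bundleSum_succ_of_notMem {w : ℕ → Chain V} {J : Finset ℕ} {α : ℕ} (h : α + 1 ∉ J) :
    bundleSum w J (α + 1) = bundleSum w J α := by
  rw [bundleSum_succ, if_neg h, add_zero]

theorem bundleSum_eq_zero {w : ℕ → Chain V} {J : Finset ℕ} {α : ℕ} (h : ∀ j ∈ J, α < j) :
    bundleSum w J α = 0 := by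
  rw [bundleSum, Finset.filter_false_of_mem (fun j hj => not_le.2 (h j hj)), Finset.sum_empty]

theorem bundleSum_mem {w : ℕ → Chain V} {J : Finset ℕ} {α : ℕ} {S : Submodule (ZMod 2) (Chain V)}
    (h : ∀ j ∈ J, w j ∈ S) : bundleSum w J α ∈ S :=
  Submodule.sum_mem _ fun j hj => h j (Finset.mem_of_mem_filter j hj)

theorem bundleSum_singleton (w : ℕ → Chain V) (b : ℕ) : bundleSum w {b} b = w b := by
  rw [bundleSum, Finset.filter_true_of_mem (by simp), Finset.sum_singleton]

end Bundles

section Basis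

variable {V : Type*} {Z Z' B B' : Submodule (ZMod 2) (Chain V)} {A : Finset ℕ} {n : ℕ}
  {v v' : ℕ → Chain V}

/-- The subspace `S` has codimension at most one in `T`. -/
def CodimLeOne (S T : Submodule (ZMod 2) (Chain V)) : Prop :=
  ∀ x ∈ T, ∀ y ∈ T, x ∉ S → y ∉ S → x + y ∈ S

/-- The chains `v b`, `b ∈ A`, represent a basis of `Z / B` over the field with two elements. -/
structure IsBasisMod (Z B : Submodule (ZMod 2) (Chain V)) (A : Finset ℕ) (v : ℕ → Chain V) :
    Prop where
  span : ∀ x ∈ Z, ∃ S ⊆ A, x + ∑ b ∈ S, v b ∈ B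
  indep : ∀ S ⊆ A, ∑ b ∈ S, v b ∈ B → S = ∅

theorem sum_add_sum_mem {S : Finset ℕ} (h : ∀ b ∈ A, v b + v' b ∈ B) (hS : S ⊆ A) :
    ∑ b ∈ S, v b + ∑ b ∈ S, v' b ∈ B := by
  rw [← Finset.sum_add_distrib]
  exact Submodule.sum_mem _ fun b hb => h b (hS hb)

theorem IsBasisMod.congr (h : IsBasisMod Z B A v) (hv : ∀ b ∈ A, v b + v' b ∈ B) :
    IsBasisMod Z B A v' where
  span x hx := by
    obtain ⟨S, hS, hxS⟩ := h.span x hx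
    refine ⟨S, hS, ?_⟩
    have := B.add_mem hxS (sum_add_sum_mem hv hS)
    rwa [add_assoc, ← add_assoc (∑ b ∈ S, v b), ZModModule.add_self, zero_add] at this
  indep S hS hsum := by
    refine h.indep S hS ?_
    exact (B.add_mem_iff_left hsum).1 (sum_add_sum_mem hv hS)

/-- Two elements outside `Z` add up to one inside it, so `v n` reduces every new element to the old
span. -/
theorem IsBasisMod.birthForward (h : IsBasisMod Z B A v) (hn : n ∉ A) (hA : ∀ b ∈ A, v b ∈ Z)
    (hB : B ≤ Z) (hn1 : v n ∈ Z') (hn2 : v n ∉ Z) (hone : CodimLeOne Z Z') :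
    IsBasisMod Z' B (insert n A) v where
  span x hx := by
    by_cases hxZ : x ∈ Z
    · obtain ⟨S, hS, hxS⟩ := h.span x hxZ
      exact ⟨S, hS.trans (Finset.subset_insert _ _), hxS⟩
    · obtain ⟨S, hS, hxS⟩ := h.span _ (hone x hx _ hn1 hxZ hn2)
      refine ⟨insert n S, Finset.insert_subset_insert n hS, ?_⟩
      rwa [Finset.sum_insert fun hnS => hn (hS hnS), ← add_assoc]
  indep S hS hsum := by
    by_cases hnS : n ∈ S
    · refine absurd ?_ hn2
      rw [← Finset.add_sum_erase S v hnS] at hsum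
      refine (Z.add_mem_iff_left (Submodule.sum_mem _ fun b hb => hA b ?_)).1 (hB hsum)
      exact Finset.mem_of_mem_insert_of_ne (hS (Finset.mem_of_mem_erase hb))
        (Finset.ne_of_mem_erase hb)
    · exact h.indep S ((Finset.subset_insert_iff_of_notMem hnS).1 hS) hsum

/-- An expansion modulo `B` has its error in `B`; if the error is outside `B'`, adding `v n`
corrects it. -/
theorem IsBasisMod.birthBackward (h : IsBasisMod Z B A v) (hn : n ∉ A) (hB : B' ≤ B)
    (hn1 : v n ∈ B) (hn2 : v n ∉ B') (hone : CodimLeOne B' B) :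
    IsBasisMod Z B' (insert n A) v where
  span x hx := by
    obtain ⟨S, hS, hxS⟩ := h.span x hx
    by_cases hxB : x + ∑ b ∈ S, v b ∈ B'
    · exact ⟨S, hS.trans (Finset.subset_insert _ _), hxB⟩
    · refine ⟨insert n S, Finset.insert_subset_insert n hS, ?_⟩
      rw [Finset.sum_insert fun hnS => hn (hS hnS), add_left_comm]
      exact hone _ hn1 _ hxS hn2 hxB
  indep S hS hsum := by
    by_cases hnS : n ∈ S
    · have h1 := hB hsum
      rw [← Finset.add_sum_erase S v hnS, B.add_mem_iff_right hn1] at h1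
      have h2 := h.indep _ (Finset.subset_insert_iff.1 hS) h1
      rw [← Finset.add_sum_erase S v hnS, h2, Finset.sum_empty, add_zero] at hsum
      exact absurd hsum hn2
    · exact h.indep S ((Finset.subset_insert_iff_of_notMem hnS).1 hS) (hB hsum)

/-- A relation among the survivors that holds modulo `B'` but not modulo `B` would, after adding `v
n`, be a relation modulo `B` that involves `n`. -/
theorem IsBasisMod.deathForward (h : IsBasisMod Z B (insert n A) v) (hn : n ∉ A) (hB : B ≤ B')
    (hn1 : v n ∈ B') (hn2 : v n ∉ B) (hone : CodimLeOne B B') : IsBasisMod Z B' A v where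
  span x hx := by
    obtain ⟨S, hS, hxS⟩ := h.span x hx
    by_cases hnS : n ∈ S
    · refine ⟨S.erase n, Finset.subset_insert_iff.1 hS, ?_⟩
      have h1 := hB hxS
      rwa [← Finset.add_sum_erase S v hnS, add_left_comm, B'.add_mem_iff_right hn1] at h1
    · exact ⟨S, (Finset.subset_insert_iff_of_notMem hnS).1 hS, hB hxS⟩
  indep S hS hsum := by
    by_cases hSB : ∑ b ∈ S, v b ∈ B
    · exact h.indep S (hS.trans (Finset.subset_insert _ _)) hSB
    · have h1 := hone _ hn1 _ hsum hn2 hSB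
      rw [← Finset.sum_insert fun hnS => hn (hS hnS)] at h1
      exact absurd (h.indep _ (Finset.insert_subset_insert n hS) h1) (Finset.insert_ne_empty _ _)

/-- Since only `v n` lies outside `Z'`, it cannot occur in the expansion of an element of `Z'`. -/
theorem IsBasisMod.deathBackward (h : IsBasisMod Z B (insert n A) v) (hZ : Z' ≤ Z)
    (hB : B ≤ Z') (hn2 : v n ∉ Z') (hA : ∀ b ∈ A, v b ∈ Z') : IsBasisMod Z' B A v where
  span x hx := by
    obtain ⟨S, hS, hxS⟩ := h.span x (hZ hx)
    refine ⟨S, (Finset.subset_insert_iff_of_notMem fun hnS => hn2 ?_).1 hS, hxS⟩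
    have h1 := (Z'.add_mem_iff_right hx).1 (hB hxS)
    rw [← Finset.add_sum_erase S v hnS] at h1
    refine (Z'.add_mem_iff_left (Submodule.sum_mem _ fun b hb => hA b ?_)).1 h1
    exact Finset.mem_of_mem_insert_of_ne (hS (Finset.mem_of_mem_erase hb))
      (Finset.ne_of_mem_erase hb)
  indep S hS hsum := h.indep S (hS.trans (Finset.subset_insert _ _)) hsum

end Basis

/-! ### Construction of the bars of a zigzag of pairs, arrow by arrow. -/

/-- The possible effects of an arrow of a zigzag of pairs of subspaces `B ≤ Z` on the quotients. -/
inductive StepKind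
  | birthForward
  | birthBackward
  | deathForward
  | deathBackward
  | const

/-- A zigzag of pairs `B i ≤ Z i` of subspaces of the chain space in which each arrow changes at
most one of the two subspaces, by one homogeneous dimension, together with chains `w (i + 1)` that
generate the quotient born at the arrow `i`, if there is one. -/
structure PairZigzag (V : Type*) (m : ℕ) (fwd : ℕ → Prop) where
  Z : ℕ → Submodule (ZMod 2) (Chain V)
  B : ℕ → Submodule (ZMod 2) (Chain V)
  G : ℕ → Submodule (ZMod 2) (Chain V)
  proj : ℕ → Chain V →ₗ[ZMod 2] Chain V
  w : ℕ → Chain V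
  kind : ℕ → StepKind
  B_le : ∀ i, B i ≤ Z i
  Z_zero : Z 0 = ⊥
  proj_mem : ∀ p i, ∀ x ∈ B i, proj p x ∈ B i
  proj_same : ∀ p, ∀ x ∈ G p, proj p x = x
  proj_ne : ∀ p q, q ≠ p → ∀ x ∈ G q, proj p x = 0
  birthForward : ∀ i < m, kind i = .birthForward → fwd i ∧ B (i + 1) = B i ∧ Z i ≤ Z (i + 1) ∧
    w (i + 1) ∈ Z (i + 1) ∧ w (i + 1) ∉ Z i ∧ (∃ p, w (i + 1) ∈ G p) ∧
    CodimLeOne (Z i) (Z (i + 1))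
  birthBackward : ∀ i < m, kind i = .birthBackward → ¬ fwd i ∧ Z (i + 1) = Z i ∧
    B (i + 1) ≤ B i ∧ w (i + 1) ∈ B i ∧ w (i + 1) ∉ B (i + 1) ∧ (∃ p, w (i + 1) ∈ G p) ∧
    CodimLeOne (B (i + 1)) (B i)
  deathForward : ∀ i < m, kind i = .deathForward → fwd i ∧ Z (i + 1) = Z i ∧ B i ≤ B (i + 1) ∧
    (∃ p, ∃ u ∈ G p, u ∈ B (i + 1) ∧ u ∉ B i) ∧ CodimLeOne (B i) (B (i + 1))
  deathBackward : ∀ i < m, kind i = .deathBackward → ¬ fwd i ∧ B (i + 1) = B i ∧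
    Z (i + 1) ≤ Z i ∧ (∃ x ∈ Z i, x ∉ Z (i + 1)) ∧
    (∃ p, ∀ q, q ≠ p → ∀ x ∈ Z i, x ∈ G q → x ∈ Z (i + 1)) ∧ CodimLeOne (Z (i + 1)) (Z i)
  const : ∀ i < m, kind i = .const → Z (i + 1) = Z i ∧ B (i + 1) = B i

namespace PairZigzag

variable {V : Type*} {m : ℕ} {fwd : ℕ → Prop} (D : PairZigzag V m fwd)

/-- Something is born at the arrow `j`. -/
def BirthAt (j : ℕ) : Prop := D.kind j = .birthForward ∨ D.kind j = .birthBackward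

/-- Something dies at the arrow `j`. -/
def DeathAt (j : ℕ) : Prop := D.kind j = .deathForward ∨ D.kind j = .deathBackward

open Classical in
/-- The birth indices. -/
def births : Finset ℕ := ((Finset.range m).filter D.BirthAt).image fun j => j + 1

/-- The index `b` belongs to a birth at a backward arrow. -/
def Back (b : ℕ) : Prop := D.kind (b - 1) = .birthBackward

theorem mem_births {b : ℕ} : b ∈ D.births ↔ ∃ j < m, D.BirthAt j ∧ j + 1 = b := by
  simp [births, and_assoc]

theorem succ_mem_births {j : ℕ} : j + 1 ∈ D.births ↔ j < m ∧ D.BirthAt j := by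
  simp [births]

/-- The chain at the index `α` of the bundle of wires `J`. -/
abbrev z (J : Finset ℕ) (α : ℕ) : Chain V := bundleSum D.w J α

/-- The bundle `J` yields a homogeneous representative on `[b,n]` that is born at `b`. -/
structure IsBar (p n b : ℕ) (J : Finset ℕ) : Prop where
  birth : b ∈ D.births
  le : b ≤ n
  subset : J ⊆ D.births
  -- No wire is scheduled beyond `n`, so prolonging the bar by one index leaves its chain unchanged.
  le_of_mem : ∀ j ∈ J, j ≤ n
  homogeneous : ∀ j ∈ J, D.w j ∈ D.G p
  cycle : ∀ α, b ≤ α → α ≤ n → D.z J α ∈ D.Z α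
  -- A wire entering after `b` lies in `B (j - 1)`, so the chain changes only by a boundary of the
  -- larger complex.
  back_of_lt : ∀ j ∈ J, b < j → D.Back j
  forward : ¬ D.Back b → D.z J b ∉ D.Z (b - 1)
  -- Thus a bar born backward has chain `w b` at `b` and the zero chain before it.
  backward : D.Back b → b ∈ J ∧ ∀ j ∈ J, b ≤ j ∧ D.Back j

open Classical in
/-- The bundle of a bar may be added to the bundles of the bars with a larger key. -/
def key (b : ℕ) : ℤ := if D.Back b then -b else b

variable {D}

/-- In key order the backward births come first, latest first, followed by the forward births,
earliest first. A smaller key leaves two possibilities. Either `b₀` is a later backward birth, whose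
chain is zero before `b₀`, so that the birth at `b` is unaffected; or `b` is a forward birth and
`b₀` is earlier, so that the chain of `J₀` is already a cycle at `b - 1` and cannot cancel the
novelty of the chain of `J`. -/
theorem IsBar.add {p n b b₀ : ℕ} {J J₀ : Finset ℕ} (h : D.IsBar p n b J) (h₀ : D.IsBar p n b₀ J₀)
    (hk : D.key b₀ < D.key b) : D.IsBar p n b (symmDiff J J₀) := by
  classical
  have mem : ∀ {P : ℕ → Prop}, (∀ j ∈ J, P j) → (∀ j ∈ J₀, P j) → ∀ j ∈ symmDiff J J₀, P j := by
    intro P h1 h2 j hj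
    rw [Finset.mem_symmDiff] at hj
    rcases hj with hj | hj
    · exact h1 j hj.1
    · exact h2 j hj.1
  have hcase : (D.Back b₀ ∧ b < b₀) ∨ (¬ D.Back b ∧ b₀ < b) := by
    unfold key at hk
    by_cases hb₀ : D.Back b₀ <;> by_cases hb : D.Back b <;>
      simp only [hb, hb₀, if_true, if_false] at hk
    · exact Or.inl ⟨hb₀, by omega⟩
    · rcases lt_trichotomy b b₀ with h1 | h1 | h1
      · exact Or.inl ⟨hb₀, h1⟩
      · subst h1; exact absurd hb₀ hb
      · exact Or.inr ⟨hb, h1⟩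
    · omega
    · exact Or.inr ⟨hb, by omega⟩
  refine ⟨h.birth, h.le, fun j hj => mem (P := fun j => j ∈ D.births) (fun j hj => h.subset hj)
    (fun j hj => h₀.subset hj) j hj, mem h.le_of_mem h₀.le_of_mem,
    mem h.homogeneous h₀.homogeneous, ?_, ?_, ?_, ?_⟩
  · intro α hb hα
    rw [z, bundleSum_symmDiff]
    refine Submodule.add_mem _ (h.cycle α hb hα) ?_
    by_cases h1 : b₀ ≤ α
    · exact h₀.cycle α h1 hα
    · rcases hcase with ⟨hB, -⟩ | h2
      · rw [bundleSum_eq_zero fun j hj => (not_le.1 h1).trans_le ((h₀.backward hB).2 j hj).1]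
        exact Submodule.zero_mem _
      · omega
  · refine mem h.back_of_lt fun j hj hbj => ?_
    rcases hcase with ⟨hB, -⟩ | h2
    · exact ((h₀.backward hB).2 j hj).2
    · exact h₀.back_of_lt j hj (h2.2.trans hbj)
  · intro hb
    rw [z, bundleSum_symmDiff, Submodule.add_mem_iff_left]
    · exact h.forward hb
    · rcases hcase with ⟨hB, h1⟩ | ⟨-, h1⟩
      · rw [bundleSum_eq_zero fun j hj => h1.trans_le ((h₀.backward hB).2 j hj).1]
        exact Submodule.zero_mem _
      · obtain ⟨a, rfl⟩ : ∃ a, b = a + 1 := ⟨b - 1, by omega⟩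
        -- The birth at `b` is not backward, so its wire is absent from `J₀` and the chain of `J₀`
        -- is the same at `b - 1` and `b`.
        rw [bundleSum_succ_of_notMem fun h2 => hb (h₀.back_of_lt _ h2 h1)]
        exact h₀.cycle a (by omega) (by have := h.le; omega)
  · intro hb
    rcases hcase with ⟨hB, h1⟩ | h2
    · refine ⟨?_, mem (h.backward hb).2 fun j hj => ?_⟩
      · rw [Finset.mem_symmDiff]
        refine Or.inl ⟨(h.backward hb).1, fun h2 => ?_⟩
        have := ((h₀.backward hB).2 b h2).1
        omega
      · have := (h₀.backward hB).2 j hj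
        exact ⟨by omega, this.2⟩
    · exact absurd hb h2.1

theorem IsBar.add_sum {p n b : ℕ} {J : Finset ℕ} (h : D.IsBar p n b J) (K : ℕ → Finset ℕ)
    (S : Finset ℕ) (hS : ∀ a ∈ S, D.IsBar p n a (K a) ∧ D.key a < D.key b) :
    ∃ J', D.IsBar p n b J' ∧ D.z J' n = D.z J n + ∑ a ∈ S, D.z (K a) n := by
  classical
  induction S using Finset.induction_on with
  | empty => exact ⟨J, h, by simp⟩
  | insert a S ha ih =>
    obtain ⟨J', h1, h2⟩ := ih fun a' ha' => hS a' (Finset.mem_insert_of_mem ha')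
    obtain ⟨h3, h4⟩ := hS a (Finset.mem_insert_self _ _)
    refine ⟨_, h1.add h3 h4, ?_⟩
    rw [z, bundleSum_symmDiff, Finset.sum_insert ha, add_left_comm, ← h2, add_comm]

theorem IsBar.mem_G {p n b α : ℕ} {J : Finset ℕ} (h : D.IsBar p n b J) : D.z J α ∈ D.G p :=
  bundleSum_mem h.homogeneous

theorem IsBar.succ {p n b : ℕ} {J : Finset ℕ} (h : D.IsBar p n b J)
    (hz : D.z J n ∈ D.Z (n + 1)) : D.IsBar p (n + 1) b J := by
  refine ⟨h.birth, h.le.trans (Nat.le_succ n), h.subset, fun j hj => ?_, h.homogeneous,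
    fun α hb hα => ?_, h.back_of_lt, h.forward, h.backward⟩
  · have := h.le_of_mem j hj
    omega
  · by_cases h1 : α = n + 1
    · subst h1
      rwa [z, bundleSum_succ_of_notMem fun h2 => absurd (h.le_of_mem _ h2) (by omega)]
    · exact h.cycle α hb (by omega)

theorem isBar_wire {i : ℕ} (hi : i < m) (hb : D.BirthAt i) :
    ∃ p, D.IsBar p (i + 1) (i + 1) {i + 1} := by
  have hmem : i + 1 ∈ D.births := D.succ_mem_births.2 ⟨hi, hb⟩
  have hG : ∃ p, D.w (i + 1) ∈ D.G p := by
    rcases hb with hb | hb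
    · exact (D.birthForward i hi hb).2.2.2.2.2.1
    · exact (D.birthBackward i hi hb).2.2.2.2.2.1
  have hZ : D.w (i + 1) ∈ D.Z (i + 1) := by
    rcases hb with hb | hb
    · exact (D.birthForward i hi hb).2.2.2.1
    · obtain ⟨-, h1, -, h2, -⟩ := D.birthBackward i hi hb
      exact h1 ▸ D.B_le i h2
  obtain ⟨p, hp⟩ := hG
  refine ⟨p, hmem, le_rfl, by simpa using hmem, by simp, by simpa using hp, fun α h1 h2 => ?_,
    by simp, fun h => ?_, fun h => ⟨by simp, by simpa using h⟩⟩
  · obtain rfl : α = i + 1 := by omega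
    rwa [z, bundleSum_singleton]
  · rw [z, bundleSum_singleton]
    rcases hb with hb | hb
    · exact (D.birthForward i hi hb).2.2.2.2.1
    · exact absurd hb h

variable (D)

/-- The chain `x` dies at the arrow `j`. -/
def Dies (j : ℕ) (x : Chain V) : Prop :=
  (D.kind j = .deathForward ∧ x ∈ D.B (j + 1) ∧ x ∉ D.B j) ∨
    (D.kind j = .deathBackward ∧ x ∉ D.Z (j + 1))

/-- Bars `[b, d b]` with bundles `J b`, for all birth indices `b ≤ i`, that decompose the part of
the zigzag up to the index `i`. -/
structure IsState (i : ℕ) (d : ℕ → ℕ) (J : ℕ → Finset ℕ) : Prop where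
  bar : ∀ b ∈ D.births, b ≤ i → ∃ p, D.IsBar p (d b) b (J b)
  le : ∀ b ∈ D.births, b ≤ i → d b ≤ i
  dies : ∀ b ∈ D.births, b ≤ i → d b < i → D.Dies (d b) (D.z (J b) (d b))
  unique : ∀ j < i, D.DeathAt j → ∃ b, ∀ b', (b' ∈ D.births ∧ b' ≤ i ∧ d b' = j) ↔ b' = b

/-- The birth indices of the bars that contain `α`. -/
def alive (d : ℕ → ℕ) (α : ℕ) : Finset ℕ := D.births.filter fun b => b ≤ α ∧ α ≤ d b

variable {D}

theorem mem_alive {d : ℕ → ℕ} {α b : ℕ} :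
    b ∈ D.alive d α ↔ b ∈ D.births ∧ b ≤ α ∧ α ≤ d b := by
  simp [alive]

theorem IsState.mem_Z {i : ℕ} {d : ℕ → ℕ} {J : ℕ → Finset ℕ} (h : D.IsState i d J) {α b : ℕ}
    (hα : α ≤ i) (hb : b ∈ D.alive d α) : D.z (J b) α ∈ D.Z α := by
  rw [mem_alive] at hb
  obtain ⟨p, hp⟩ := h.bar b hb.1 (hb.2.1.trans hα)
  exact hp.cycle α hb.2.1 hb.2.2

/-- The induction runs over `α` inside one fixed state. The basis at each earlier index is thus
recovered from the final bundles, and need not be tracked while bundles are being replaced. -/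
theorem IsState.isBasisMod {i : ℕ} (hi : i ≤ m) {d : ℕ → ℕ} {J : ℕ → Finset ℕ}
    (h : D.IsState i d J) {α : ℕ} (hα : α ≤ i) :
    IsBasisMod (D.Z α) (D.B α) (D.alive d α) fun b => D.z (J b) α := by
  classical
  induction α with
  | zero =>
    have hA : D.alive d 0 = ∅ := by
      refine Finset.eq_empty_of_forall_notMem fun b hb => ?_
      rw [mem_alive, mem_births] at hb
      obtain ⟨⟨j, -, -, rfl⟩, h1, -⟩ := hb
      omega
    rw [hA, D.Z_zero]
    exact ⟨fun x hx => ⟨∅, by simp, by simp [(Submodule.mem_bot _).1 hx]⟩,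
      fun S hS _ => Finset.subset_empty.1 hS⟩
  | succ α ih =>
    have hαm : α < m := by omega
    have ih := ih (by omega)
    have hdies : ∀ b ∈ D.alive d α, d b = α → D.Dies α (D.z (J b) α) := by
      intro b hb hd
      rw [mem_alive] at hb
      have := h.dies b hb.1 (by omega) (by omega)
      rwa [hd] at this
    have hcongr : ¬ D.Back (α + 1) → IsBasisMod (D.Z α) (D.B α) (D.alive d α)
        fun b => D.z (J b) (α + 1) := by
      refine fun hB => ih.congr fun b hb => ?_
      rw [mem_alive] at hb
      obtain ⟨p, hp⟩ := h.bar b hb.1 (by omega)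
      rw [z, z, bundleSum_succ_of_notMem fun h1 => hB (hp.back_of_lt _ h1 (by omega)),
        ZModModule.add_self]
      exact Submodule.zero_mem _
    have hnot : ¬ D.DeathAt α → ∀ b ∈ D.alive d α, d b ≠ α := by
      intro hD b hb hd
      exact hD ((hdies b hb hd).imp And.left And.left)
    have halive_birth : D.BirthAt α → ¬ D.DeathAt α →
        D.alive d (α + 1) = insert (α + 1) (D.alive d α) := by
      intro hB hD
      have hmem : α + 1 ∈ D.births := D.succ_mem_births.2 ⟨hαm, hB⟩
      ext b
      rw [Finset.mem_insert]
      constructor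
      · intro hb
        rw [mem_alive] at hb ⊢
        by_cases h1 : b = α + 1
        · exact Or.inl h1
        · exact Or.inr ⟨hb.1, by omega, by omega⟩
      · rintro (rfl | hb)
        · obtain ⟨p, hp⟩ := h.bar _ hmem hα
          exact mem_alive.2 ⟨hmem, le_rfl, hp.le⟩
        · have h1 := hnot hD b hb
          rw [mem_alive] at hb ⊢
          exact ⟨hb.1, by omega, by omega⟩
    have halive_const : ¬ D.BirthAt α → ¬ D.DeathAt α → D.alive d (α + 1) = D.alive d α := by
      intro hB hD
      ext b
      constructor
      · intro hb
        rw [mem_alive] at hb ⊢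
        have h1 : b ≠ α + 1 := fun h1 => hB (D.succ_mem_births.1 (h1 ▸ hb.1)).2
        exact ⟨hb.1, by omega, by omega⟩
      · intro hb
        have h1 := hnot hD b hb
        rw [mem_alive] at hb ⊢
        exact ⟨hb.1, by omega, by omega⟩
    have halive_death : ¬ D.BirthAt α → D.DeathAt α → ∃ n ∉ D.alive d (α + 1),
        D.alive d α = insert n (D.alive d (α + 1)) ∧ D.Dies α (D.z (J n) α) := by
      intro hB hD
      obtain ⟨n, hn⟩ := h.unique α hα hD
      have h1 := (hn n).2 rfl
      obtain ⟨p, hp⟩ := h.bar n h1.1 h1.2.1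
      have hnα : n ∈ D.alive d α := mem_alive.2 ⟨h1.1, h1.2.2 ▸ hp.le, h1.2.2.ge⟩
      refine ⟨n, fun h2 => ?_, ?_, hdies n hnα h1.2.2⟩
      · rw [mem_alive] at h2
        omega
      · ext b
        rw [Finset.mem_insert]
        constructor
        · intro hb
          by_cases h2 : b = n
          · exact Or.inl h2
          · right
            rw [mem_alive] at hb ⊢
            have h3 : d b ≠ α := fun h3 => h2 ((hn b).1 ⟨hb.1, by omega, h3⟩)
            exact ⟨hb.1, by omega, by omega⟩
        · rintro (rfl | hb)
          · exact hnα
          · rw [mem_alive] at hb ⊢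
            have h1 : b ≠ α + 1 := fun h1 => hB (D.succ_mem_births.1 (h1 ▸ hb.1)).2
            exact ⟨hb.1, by omega, by omega⟩
    have hnew : α + 1 ∉ D.alive d α := by
      rw [mem_alive]
      omega
    have hz : ∀ b ∈ D.alive d α, ¬ D.Back (α + 1) → D.z (J b) (α + 1) = D.z (J b) α := by
      intro b hb hB
      rw [mem_alive] at hb
      obtain ⟨p, hp⟩ := h.bar b hb.1 (by omega)
      exact bundleSum_succ_of_notMem fun h1 => hB (hp.back_of_lt _ h1 (by omega))
    rcases hk : D.kind α with _ | _ | _ | _ | _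
    · obtain ⟨-, hB, hZ, hw1, hw2, -, hone⟩ := D.birthForward α hαm hk
      have hbirth : D.BirthAt α := Or.inl hk
      have hback : ¬ D.Back (α + 1) := by simp [Back, hk]
      have hmem : α + 1 ∈ D.births := D.succ_mem_births.2 ⟨hαm, hbirth⟩
      obtain ⟨p, hp⟩ := h.bar _ hmem hα
      rw [halive_birth hbirth (by simp [DeathAt, hk]), hB]
      refine (hcongr hback).birthForward hnew (fun b hb => ?_) (D.B_le α)
        (hp.cycle _ le_rfl hp.le) (hp.forward hback) hone
      rw [hz b hb hback]
      exact h.mem_Z (by omega) hb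
    · obtain ⟨-, hZ, hB, hw1, hw2, -, hone⟩ := D.birthBackward α hαm hk
      have hbirth : D.BirthAt α := Or.inr hk
      have hback : D.Back (α + 1) := by simp [Back, hk]
      have hmem : α + 1 ∈ D.births := D.succ_mem_births.2 ⟨hαm, hbirth⟩
      obtain ⟨p, hp⟩ := h.bar _ hmem hα
      -- All wires of a bundle born backward have index at least that of its birth, so only the
      -- first one counts here.
      have hzn : D.z (J (α + 1)) (α + 1) = D.w (α + 1) := by
        rw [z, bundleSum_succ, if_pos (hp.backward hback).1,
          bundleSum_eq_zero fun j hj => ((hp.backward hback).2 j hj).1, zero_add]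
      rw [halive_birth hbirth (by simp [DeathAt, hk]), hZ]
      -- Older bars may pick up `w (α + 1)`, which lies in `B α` but not in `B (α + 1)`; the vectors
      -- must therefore be exchanged before `B` shrinks.
      refine (ih.congr fun b hb => ?_).birthBackward hnew hB (by rwa [hzn]) (by rwa [hzn]) hone
      rw [z, z, bundleSum_succ, ← add_assoc, ZModModule.add_self, zero_add]
      split_ifs
      · exact hw1
      · exact Submodule.zero_mem _
    · obtain ⟨-, hZ, hB, -, hone⟩ := D.deathForward α hαm hk
      have hback : ¬ D.Back (α + 1) := by simp [Back, hk]
      obtain ⟨n, hn, hA, hd⟩ := halive_death (by simp [BirthAt, hk]) (Or.inl hk)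
      simp only [Dies, hk, reduceCtorEq, false_and, or_false, true_and] at hd
      have hcg := hcongr hback
      have hzn := hz n (hA ▸ Finset.mem_insert_self _ _) hback
      rw [hA] at hcg
      rw [hZ]
      exact hcg.deathForward hn hB (hzn ▸ hd.1) (hzn ▸ hd.2) hone
    · obtain ⟨-, hB, hZ, -, -, hone⟩ := D.deathBackward α hαm hk
      have hback : ¬ D.Back (α + 1) := by simp [Back, hk]
      obtain ⟨n, hn, hA, hd⟩ := halive_death (by simp [BirthAt, hk]) (Or.inr hk)
      simp only [Dies, hk, reduceCtorEq, false_and, false_or, true_and] at hd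
      have hcg := hcongr hback
      have hzn := hz n (hA ▸ Finset.mem_insert_self _ _) hback
      rw [hA] at hcg
      rw [hB]
      exact hcg.deathBackward hZ (hB ▸ D.B_le (α + 1)) (hzn ▸ hd) fun b hb => h.mem_Z hα hb
    · obtain ⟨hZ, hB⟩ := D.const α hαm hk
      rw [halive_const (by simp [BirthAt, hk]) (by simp [DeathAt, hk]), hZ, hB]
      exact hcongr (by simp [Back, hk])

/-- Passage from the index `i` to the index `i + 1`: the bars in `K` end, the others survive. -/
theorem IsState.advance {i : ℕ} (hi : i < m) {d : ℕ → ℕ} {J : ℕ → Finset ℕ}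
    (h : D.IsState i d J) (K : Finset ℕ) (J₁ : ℕ → Finset ℕ)
    (hJ₁ : ∀ b ∈ D.alive d i, ∃ p, D.IsBar p i b (J₁ b)) (hK : K ⊆ D.alive d i)
    (hdies : ∀ b ∈ K, D.Dies i (D.z (J₁ b) i))
    (hsurv : ∀ b ∈ D.alive d i, b ∉ K → D.z (J₁ b) i ∈ D.Z (i + 1))
    (hunique : D.DeathAt i → ∃ b, K = {b}) : ∃ d' J', D.IsState (i + 1) d' J' := by
  classical
  have halive : ∀ b, b ∈ D.births → b ≤ i → d b = i → b ∈ D.alive d i :=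
    fun b h1 h2 h3 => mem_alive.2 ⟨h1, h2, h3.ge⟩
  -- Only the bars with `d b = i` are open and get modified. The value at `i + 1` is harmless if
  -- nothing is born there, as states look at birth indices only.
  let d' : ℕ → ℕ := fun b => if b = i + 1 then i + 1 else
    if d b = i then if b ∈ K then i else i + 1 else d b
  let J' : ℕ → Finset ℕ := fun b => if b = i + 1 then {i + 1} else
    if d b = i then J₁ b else J b
  have hold : ∀ b ∈ D.births, b ≤ i → d b ≠ i → d' b = d b ∧ J' b = J b := by
    intro b hb hbi hd
    have h1 : b ≠ i + 1 := by omega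
    simp [d', J', h1, hd]
  have hkill : ∀ b ∈ K, d' b = i ∧ J' b = J₁ b := by
    intro b hb
    have h1 := mem_alive.1 (hK hb)
    have h2 := h.le b h1.1 h1.2.1
    have h3 : b ≠ i + 1 := by omega
    have h4 : d b = i := by omega
    simp [d', J', h3, h4, hb]
  have hlive : ∀ b ∈ D.births, b ≤ i → d b = i → b ∉ K → d' b = i + 1 ∧ J' b = J₁ b := by
    intro b hb hbi hd hbK
    have h3 : b ≠ i + 1 := by omega
    simp [d', J', h3, hd, hbK]
  have hnew : d' (i + 1) = i + 1 ∧ J' (i + 1) = {i + 1} := by simp [d', J']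
  have hcases : ∀ b ∈ D.births, b ≤ i + 1 → b = i + 1 ∨ b ∈ K ∨
      (b ≤ i ∧ d b = i ∧ b ∉ K) ∨ (b ≤ i ∧ d b ≠ i) := by
    intro b hb hbi
    by_cases h1 : b = i + 1
    · exact Or.inl h1
    · have : b ≤ i := by omega
      tauto
  refine ⟨d', J', fun b hb hbi => ?_, fun b hb hbi => ?_, fun b hb hbi hd => ?_,
    fun j hj hD => ?_⟩
  · rcases hcases b hb hbi with rfl | h1 | ⟨h1, h2, h3⟩ | ⟨h1, h2⟩
    · rw [hnew.1, hnew.2]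
      exact isBar_wire hi (D.succ_mem_births.1 hb).2
    · rw [(hkill b h1).1, (hkill b h1).2]
      exact hJ₁ b (hK h1)
    · obtain ⟨h4, h5⟩ := hlive b hb h1 h2 h3
      have h6 := halive b hb h1 h2
      obtain ⟨p, hp⟩ := hJ₁ b h6
      rw [h4, h5]
      exact ⟨p, hp.succ (hsurv b h6 h3)⟩
    · rw [(hold b hb h1 h2).1, (hold b hb h1 h2).2]
      exact h.bar b hb h1
  · rcases hcases b hb hbi with rfl | h1 | ⟨h1, h2, h3⟩ | ⟨h1, h2⟩
    · exact hnew.1.le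
    · rw [(hkill b h1).1]
      omega
    · rw [(hlive b hb h1 h2 h3).1]
    · rw [(hold b hb h1 h2).1]
      exact (h.le b hb h1).trans (Nat.le_succ i)
  · rcases hcases b hb hbi with rfl | h1 | ⟨h1, h2, h3⟩ | ⟨h1, h2⟩
    · omega
    · rw [(hkill b h1).1, (hkill b h1).2]
      exact hdies b h1
    · have := (hlive b hb h1 h2 h3).1
      omega
    · rw [(hold b hb h1 h2).1, (hold b hb h1 h2).2]
      exact h.dies b hb h1 (lt_of_le_of_ne (h.le b hb h1) h2)
  · by_cases hji : j = i
    · subst hji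
      obtain ⟨b, rfl⟩ := hunique hD
      refine ⟨b, fun b' => ⟨fun ⟨h1, h2, h3⟩ => ?_, ?_⟩⟩
      · rcases hcases b' h1 h2 with rfl | h4 | ⟨h4, h5, h6⟩ | ⟨h4, h5⟩
        · omega
        · exact Finset.mem_singleton.1 h4
        · have := (hlive b' h1 h4 h5 h6).1
          omega
        · have := (hold b' h1 h4 h5).1
          omega
      · rintro rfl
        have h1 := hK (Finset.mem_singleton_self b')
        rw [mem_alive] at h1
        exact ⟨h1.1, by omega, (hkill b' (Finset.mem_singleton_self b')).1⟩
    · obtain ⟨b, hb⟩ := h.unique j (by omega) hD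
      refine ⟨b, fun b' => ⟨fun ⟨h1, h2, h3⟩ => (hb b').1 ?_, ?_⟩⟩
      · rcases hcases b' h1 h2 with rfl | h4 | ⟨h4, h5, h6⟩ | ⟨h4, h5⟩
        · omega
        · have := (hkill b' h4).1
          omega
        · have := (hlive b' h1 h4 h5 h6).1
          omega
        · have := (hold b' h1 h4 h5).1
          exact ⟨h1, h4, by omega⟩
      · rintro rfl
        obtain ⟨h1, h2, h3⟩ := (hb b').2 rfl
        exact ⟨h1, by omega, by rw [(hold b' h1 h2 (by omega)).1, h3]⟩

/-- Births and constant arrows leave all open bars alive. At a death the key order decides which bar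
ends, so that every bundle addition needed is one that `IsBar.add` permits. -/
theorem IsState.exists_succ {i : ℕ} (hi : i < m) {d : ℕ → ℕ} {J : ℕ → Finset ℕ}
    (h : D.IsState i d J) : ∃ d' J', D.IsState (i + 1) d' J' := by
  classical
  have hbasis := h.isBasisMod hi.le le_rfl
  have hbar : ∀ b ∈ D.alive d i, ∃ p, D.IsBar p i b (J b) := by
    intro b hb
    rw [mem_alive] at hb
    have h1 := h.le b hb.1 hb.2.1
    have h2 := h.bar b hb.1 hb.2.1
    rwa [show d b = i by omega] at h2
  have hkey : ∀ a ∈ D.births, ∀ b ∈ D.births, D.key a = D.key b → a = b := by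
    intro a ha b hb hab
    rw [mem_births] at ha hb
    obtain ⟨j, -, -, rfl⟩ := ha
    obtain ⟨k, -, -, rfl⟩ := hb
    unfold key at hab
    split_ifs at hab <;> omega
  have hsimple : D.Z i ≤ D.Z (i + 1) → ¬ D.DeathAt i → ∃ d' J', D.IsState (i + 1) d' J' :=
    fun hZ hD => h.advance hi ∅ J hbar (by simp) (by simp)
      (fun b hb _ => hZ (h.mem_Z le_rfl hb)) fun h1 => absurd h1 hD
  rcases hk : D.kind i with _ | _ | _ | _ | _
  · exact hsimple (D.birthForward i hi hk).2.2.1 (by simp [DeathAt, hk])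
  · exact hsimple (D.birthBackward i hi hk).2.1.ge (by simp [DeathAt, hk])
  · obtain ⟨-, hZ, hB, ⟨p, u, hup, hu1, hu2⟩, hone⟩ := D.deathForward i hi hk
    obtain ⟨S, hS, huS⟩ := hbasis.span u (hZ ▸ D.B_le (i + 1) hu1)
    -- Projection to degree `p` fixes `u`, preserves `B i` and kills the bars of other degrees, so
    -- the expansion may be cut down to bars of degree `p`.
    let T := S.filter fun b => D.IsBar p i b (J b)
    have hT : u + ∑ b ∈ T, D.z (J b) i ∈ D.B i := by
      have h1 := D.proj_mem p i _ huS
      rw [map_add, D.proj_same p u hup, map_sum] at h1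
      convert h1 using 2
      rw [Finset.sum_filter]
      refine Finset.sum_congr rfl fun b hb => ?_
      split_ifs with h2
      · exact (D.proj_same p _ h2.mem_G).symm
      · obtain ⟨q, hq⟩ := hbar b (hS hb)
        have hqp : q ≠ p := fun h3 => h2 (h3 ▸ hq)
        exact (D.proj_ne p q hqp _ hq.mem_G).symm
    have hTne : T.Nonempty := by
      rw [Finset.nonempty_iff_ne_empty]
      intro h1
      rw [h1, Finset.sum_empty, add_zero] at hT
      exact hu2 hT
    have hTS : T ⊆ D.alive d i := (Finset.filter_subset _ _).trans hS
    -- The bar of largest key may absorb all the others; its new chain agrees with `u` modulo `B i`,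
    -- and so dies at this arrow.
    obtain ⟨b, hb, hmax⟩ := T.exists_max_image D.key hTne
    have hTbar : ∀ a ∈ T, D.IsBar p i a (J a) := fun a ha => (Finset.mem_filter.1 ha).2
    obtain ⟨J', hJ', hz⟩ := (hTbar b hb).add_sum J (T.erase b) fun a ha => by
      refine ⟨hTbar a (Finset.mem_of_mem_erase ha),
        lt_of_le_of_ne (hmax a (Finset.mem_of_mem_erase ha)) fun h1 => ?_⟩
      exact Finset.ne_of_mem_erase ha (hkey a (hTbar a (Finset.mem_of_mem_erase ha)).birth b
        (hTbar b hb).birth h1)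
    rw [Finset.add_sum_erase T (fun a => D.z (J a) i) hb] at hz
    refine h.advance hi {b} (Function.update J b J') (fun a ha => ?_) (by simpa using hTS hb) ?_
      (fun a ha hab => ?_) fun _ => ⟨b, rfl⟩
    · by_cases hab : a = b
      · subst hab
        rw [Function.update_self]
        exact ⟨p, hJ'⟩
      · rw [Function.update_of_ne hab]
        exact hbar a ha
    · intro a ha
      obtain rfl := Finset.mem_singleton.1 ha
      rw [Function.update_self, hz]
      refine Or.inl ⟨hk, ?_, fun h1 => hu2 ?_⟩
      · exact ((D.B (i + 1)).add_mem_iff_right hu1).1 (hB hT)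
      · exact ((D.B i).add_mem_iff_left h1).1 hT
    · rw [Finset.mem_singleton] at hab
      rw [Function.update_of_ne hab, hZ]
      exact h.mem_Z le_rfl ha
  · obtain ⟨-, hB, hZ, ⟨x, hx1, hx2⟩, ⟨p, hp⟩, hone⟩ := D.deathBackward i hi hk
    -- These are the open bars whose cycles do not survive. Some exist, because otherwise the basis
    -- would put all of `Z i` inside `Z (i + 1)`.
    let T := (D.alive d i).filter fun b => D.z (J b) i ∉ D.Z (i + 1)
    have hTne : T.Nonempty := by
      by_contra h1
      rw [Finset.not_nonempty_iff_eq_empty, Finset.filter_eq_empty_iff] at h1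
      obtain ⟨S, hS, hxS⟩ := hbasis.span x hx1
      rw [← hB] at hxS
      refine hx2 (((D.Z (i + 1)).add_mem_iff_left ?_).1 (D.B_le _ hxS))
      exact Submodule.sum_mem _ fun b hb => not_not.1 (h1 (hS hb))
    have hTbar : ∀ a ∈ T, D.IsBar p i a (J a) := by
      intro a ha
      obtain ⟨h1, h2⟩ := Finset.mem_filter.1 ha
      obtain ⟨q, hq⟩ := hbar a h1
      by_cases hqp : q = p
      · exact hqp ▸ hq
      · exact absurd (hp q hqp _ (h.mem_Z le_rfl h1) hq.mem_G) h2
    obtain ⟨b, hb, hmin⟩ := T.exists_min_image D.key hTne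
    have hb2 := (Finset.mem_filter.1 hb).2
    -- The bar of smallest key may be added to all the others; by codimension one the sums lie in `Z
    -- (i + 1)` again, and `b` dies with its own bundle.
    let J₁ : ℕ → Finset ℕ := fun a => if a ∈ T ∧ a ≠ b then symmDiff (J a) (J b) else J a
    refine h.advance hi {b} J₁ (fun a ha => ?_)
      (by simpa using (Finset.mem_filter.1 hb).1) ?_ (fun a ha hab => ?_) fun _ => ⟨b, rfl⟩
    · by_cases h1 : a ∈ T ∧ a ≠ b
      · simp only [J₁, if_pos h1]
        refine ⟨p, (hTbar a h1.1).add (hTbar b hb) (lt_of_le_of_ne (hmin a h1.1) fun h2 => ?_)⟩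
        exact h1.2 (hkey b (hTbar b hb).birth a (hTbar a h1.1).birth h2).symm
      · simp only [J₁, if_neg h1]
        exact hbar a ha
    · intro a ha
      obtain rfl := Finset.mem_singleton.1 ha
      simp only [J₁, ne_eq, not_true_eq_false, and_false, if_false]
      exact Or.inr ⟨hk, hb2⟩
    · rw [Finset.mem_singleton] at hab
      by_cases h1 : a ∈ T
      · simp only [J₁, h1, ne_eq, hab, not_false_eq_true, and_self, if_true]
        rw [z, bundleSum_symmDiff]
        exact hone _ (h.mem_Z le_rfl ha) _ (h.mem_Z le_rfl (Finset.mem_filter.1 hb).1)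
          (Finset.mem_filter.1 h1).2 hb2
      · simp only [J₁, h1, false_and, if_false]
        by_contra h2
        exact h1 (Finset.mem_filter.2 ⟨ha, h2⟩)
  · exact hsimple (D.const i hi hk).1.ge (by simp [DeathAt, hk])

variable (D) in
theorem exists_isState : ∀ i ≤ m, ∃ d J, D.IsState i d J := by
  intro i
  induction i with
  | zero =>
    have hb : ∀ b ∈ D.births, ¬ b ≤ 0 := by
      intro b hb
      obtain ⟨j, -, -, rfl⟩ := D.mem_births.1 hb
      omega
    exact fun _ => ⟨fun _ => 0, fun _ => ∅, fun b h1 h2 => absurd h2 (hb b h1),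
      fun b h1 h2 => absurd h2 (hb b h1), fun b h1 h2 => absurd h2 (hb b h1), by omega⟩
  | succ i ih =>
    intro hi
    obtain ⟨d, J, h⟩ := ih (by omega)
    exact h.exists_succ hi

end PairZigzag

end WireZigzag

end

/-! ### From bars to an interval decomposition of the module. -/

noncomputable section

namespace WireZigzag

namespace PairZigzag

variable {V : Type*} {m : ℕ} {fwd : ℕ → Prop} {D : PairZigzag V m fwd}

theorem not_back_of_fwd {j : ℕ} (hj : j < m) (hf : fwd j) : ¬ D.Back (j + 1) :=
  fun h => (D.birthBackward j hj h).1 hf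

theorem IsBar.z_succ_of_fwd {p n b α : ℕ} {J : Finset ℕ} (h : D.IsBar p n b J) (hb : b ≤ α)
    (hα : α < m) (hf : fwd α) : D.z J (α + 1) = D.z J α :=
  bundleSum_succ_of_notMem fun h1 => not_back_of_fwd hα hf (h.back_of_lt _ h1 (by omega))

theorem IsBar.z_succ_add_mem {p n b α : ℕ} {J : Finset ℕ} (h : D.IsBar p n b J) (hb : b ≤ α)
    (hα : α < m) : D.z J (α + 1) + D.z J α ∈ D.B α := by
  rw [z, z, bundleSum_succ, add_right_comm, ZModModule.add_self, zero_add]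
  split_ifs with h1
  · exact (D.birthBackward α hα (h.back_of_lt _ h1 (by omega))).2.2.2.1
  · exact Submodule.zero_mem _

theorem IsBar.birthAt {p n j : ℕ} {J : Finset ℕ} (h : D.IsBar p n (j + 1) J) :
    j < m ∧ D.BirthAt j :=
  D.succ_mem_births.1 h.birth

theorem IsBar.notMem_of_fwd {p n j : ℕ} {J : Finset ℕ} (h : D.IsBar p n (j + 1) J)
    (hf : fwd j) : D.z J (j + 1) ∉ D.Z j :=
  h.forward (not_back_of_fwd h.birthAt.1 hf)

theorem IsBar.mem_of_not_fwd {p n j : ℕ} {J : Finset ℕ} (h : D.IsBar p n (j + 1) J)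
    (hf : ¬ fwd j) : D.z J (j + 1) ∈ D.B j ∧ D.z J (j + 1) ∉ D.B (j + 1) := by
  obtain ⟨hj, hB⟩ := h.birthAt
  have hk : D.kind j = .birthBackward := hB.resolve_left fun h1 => hf (D.birthForward j hj h1).1
  obtain ⟨-, -, -, hw1, hw2, -⟩ := D.birthBackward j hj hk
  have h1 := h.backward hk
  have hz : D.z J (j + 1) = D.w (j + 1) := by
    rw [z, bundleSum_succ, if_pos h1.1, bundleSum_eq_zero fun i hi => (h1.2 i hi).1, zero_add]
  exact hz ▸ ⟨hw1, hw2⟩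

theorem Dies.of_fwd {j : ℕ} {x : Chain V} (h : D.Dies j x) (hj : j < m) (hf : fwd j) :
    x ∈ D.B (j + 1) ∧ x ∉ D.B j :=
  (h.resolve_right fun h1 => (D.deathBackward j hj h1.1).1 hf).2

theorem Dies.of_not_fwd {j : ℕ} {x : Chain V} (h : D.Dies j x) (hj : j < m) (hf : ¬ fwd j) :
    x ∉ D.Z (j + 1) :=
  (h.resolve_left fun h1 => hf (D.deathForward j hj h1.1).1).2

variable (D)

/-- The zigzag module `M` consists of the quotients `Z i / B i`, with class maps `cls`. -/
structure Presents (M : ZigzagModule m fwd) (cls : ∀ i, D.Z i →ₗ[ZMod 2] M.X i) : Prop where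
  surjective : ∀ i, Function.Surjective (cls i)
  eq_zero_iff : ∀ i (x : D.Z i), cls i x = 0 ↔ (x : Chain V) ∈ D.B i
  forward : ∀ i (hi : i < m) (hf : fwd i) (x : Chain V) (hx : x ∈ D.Z i) (hx' : x ∈ D.Z (i + 1)),
    M.forward i hi hf (cls i ⟨x, hx⟩) = cls (i + 1) ⟨x, hx'⟩
  backward : ∀ i (hi : i < m) (hf : ¬ fwd i) (x : Chain V) (hx : x ∈ D.Z i)
    (hx' : x ∈ D.Z (i + 1)), M.backward i hi hf (cls (i + 1) ⟨x, hx'⟩) = cls i ⟨x, hx⟩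

variable {D} {M : ZigzagModule m fwd} {cls : ∀ i, D.Z i →ₗ[ZMod 2] M.X i}

theorem Presents.eq_of_add_mem (hM : D.Presents M cls) {i : ℕ} {x y : D.Z i}
    (h : (x : Chain V) + y ∈ D.B i) : cls i x = cls i y := by
  rw [← sub_eq_zero, ← map_sub, hM.eq_zero_iff, ZModModule.sub_eq_add]
  exact h

section Vectors

variable (cls)

open Classical in
/-- The basis vector of the bar `[b, d b]` at the index `α`. -/
def barVector (d : ℕ → ℕ) (J : ℕ → Finset ℕ) (α b : ℕ) : M.X α :=
  if h : b ∈ D.alive d α ∧ D.z (J b) α ∈ D.Z α then cls α ⟨D.z (J b) α, h.2⟩ else 0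

variable {cls} {d : ℕ → ℕ} {J : ℕ → Finset ℕ}

theorem barVector_of_mem {α b : ℕ} (hb : b ∈ D.alive d α) (hz : D.z (J b) α ∈ D.Z α) :
    barVector cls d J α b = cls α ⟨D.z (J b) α, hz⟩ :=
  dif_pos ⟨hb, hz⟩

theorem barVector_of_notMem {α b : ℕ} (hb : b ∉ D.alive d α) : barVector cls d J α b = 0 :=
  dif_neg fun h => hb h.1

/-- A bar that ends at a forward arrow becomes a boundary there and maps to zero; any other bar
keeps its chain, since no wire enters a bar after its birth along a forward arrow. -/
theorem IsState.forward_barVector (hM : D.Presents M cls) (h : D.IsState m d J) {α b : ℕ}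
    (hα : α < m) (hf : fwd α) (hb : b ∈ D.alive d α) :
    M.forward α hα hf (barVector cls d J α b) = barVector cls d J (α + 1) b := by
  have hz := h.mem_Z hα.le hb
  obtain ⟨h1, h2, h3⟩ := mem_alive.1 hb
  obtain ⟨p, hp⟩ := h.bar b h1 (by omega)
  rw [barVector_of_mem hb hz]
  by_cases h4 : d b = α
  · have h5 := h.dies b h1 (by omega) (by omega)
    rw [h4] at h5
    have h6 := (h5.of_fwd hα hf).1
    rw [barVector_of_notMem fun h7 => by have := mem_alive.1 h7; omega,
      hM.forward α hα hf _ hz (D.B_le _ h6)]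
    exact (hM.eq_zero_iff _ _).2 h6
  · have h5 : b ∈ D.alive d (α + 1) := mem_alive.2 ⟨h1, by omega, by omega⟩
    have h6 := h.mem_Z hα h5
    rw [barVector_of_mem h5 h6]
    have h7 := hp.z_succ_of_fwd h2 hα hf
    rw [hM.forward α hα hf _ hz (h7 ▸ h6)]
    congr 1
    exact Subtype.ext h7.symm

/-- A bar born at a backward arrow starts with an element of `B α` and maps to zero; for an older
bar the two chains differ by an element of `B α`. -/
theorem IsState.backward_barVector (hM : D.Presents M cls) (h : D.IsState m d J) {α b : ℕ}
    (hα : α < m) (hf : ¬ fwd α) (hb : b ∈ D.alive d (α + 1)) :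
    M.backward α hα hf (barVector cls d J (α + 1) b) = barVector cls d J α b := by
  have hz := h.mem_Z hα hb
  obtain ⟨h1, h2, h3⟩ := mem_alive.1 hb
  obtain ⟨p, hp⟩ := h.bar b h1 (by omega)
  rw [barVector_of_mem hb hz]
  by_cases h4 : b = α + 1
  · subst h4
    have h6 := (hp.mem_of_not_fwd hf).1
    rw [barVector_of_notMem fun h7 => by have := mem_alive.1 h7; omega,
      hM.backward α hα hf _ (D.B_le _ h6) hz]
    exact (hM.eq_zero_iff _ _).2 h6
  · have h5 : b ∈ D.alive d α := mem_alive.2 ⟨h1, by omega, by omega⟩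
    have h6 := h.mem_Z hα.le h5
    have h7 := hp.z_succ_add_mem (by omega : b ≤ α) hα
    rw [barVector_of_mem h5 h6, hM.backward α hα hf _ (((D.Z α).add_mem_iff_left h6).1
      (D.B_le _ h7)) hz]
    exact hM.eq_of_add_mem h7

theorem IsState.cls_sum (h : D.IsState m d J) {α : ℕ} (hα : α ≤ m) {S : Finset ℕ}
    (hS : S ⊆ D.alive d α) (hz : ∑ b ∈ S, D.z (J b) α ∈ D.Z α) :
    cls α ⟨∑ b ∈ S, D.z (J b) α, hz⟩ = ∑ b ∈ S, barVector cls d J α b := by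
  classical
  induction S using Finset.induction_on with
  | empty => exact map_zero _
  | insert b S hb ih =>
    have h1 := h.mem_Z hα (hS (Finset.mem_insert_self b S))
    have h2 : ∑ b ∈ S, D.z (J b) α ∈ D.Z α := by
      rwa [Finset.sum_insert hb, (D.Z α).add_mem_iff_right h1] at hz
    have h3 : (⟨∑ b ∈ insert b S, D.z (J b) α, hz⟩ : D.Z α) =
        ⟨D.z (J b) α, h1⟩ + ⟨∑ b ∈ S, D.z (J b) α, h2⟩ := Subtype.ext (Finset.sum_insert hb)
    rw [h3, map_add, ih ((Finset.subset_insert _ _).trans hS) h2, Finset.sum_insert hb,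
      barVector_of_mem (hS (Finset.mem_insert_self b S)) h1]

/-- The birth indices, enumerated. -/
def birthEquiv (D : PairZigzag V m fwd) : Fin D.births.card ≃ D.births := D.births.equivFin.symm

/-- The intervals of the bars. -/
def bars (D : PairZigzag V m fwd) (d : ℕ → ℕ) (k : Fin D.births.card) : ℕ × ℕ :=
  (D.birthEquiv k, d (D.birthEquiv k))

/-- The comparison of the direct sum of the interval modules of the bars with `M`. -/
def barMap (cls : ∀ i, D.Z i →ₗ[ZMod 2] M.X i) (d : ℕ → ℕ) (J : ℕ → Finset ℕ) (α : ℕ) :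
    (∀ k, ZigzagModule.intervalSpace (D.bars d k).1 (D.bars d k).2 α) →ₗ[ZMod 2] M.X α :=
  ∑ k, (LinearMap.toSpanSingleton (ZMod 2) (M.X α) (barVector cls d J α (D.birthEquiv k))) ∘ₗ
    Submodule.subtype _ ∘ₗ LinearMap.proj k

theorem barMap_apply (α : ℕ)
    (c : ∀ k, ZigzagModule.intervalSpace (D.bars d k).1 (D.bars d k).2 α) :
    barMap cls d J α c = ∑ k, (c k : ZMod 2) • barVector cls d J α (D.birthEquiv k) := by
  simp [barMap]

theorem mem_alive_birthEquiv {α : ℕ} {k : Fin D.births.card} :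
    (D.birthEquiv k : ℕ) ∈ D.alive d α ↔ (D.bars d k).1 ≤ α ∧ α ≤ (D.bars d k).2 := by
  rw [mem_alive]
  exact and_iff_right (D.birthEquiv k).2

/-- A coefficient vector over the field with two elements amounts to its support, which turns the
two halves of `IsBasisMod` into injectivity and surjectivity. -/
theorem IsState.barMap_bijective (hM : D.Presents M cls) (h : D.IsState m d J) {α : ℕ}
    (hα : α ≤ m) : Function.Bijective (barMap cls d J α) := by
  classical
  have hbasis := h.isBasisMod le_rfl hα
  have hsum : ∀ S ⊆ D.alive d α, ∑ b ∈ S, D.z (J b) α ∈ D.Z α := fun S hS =>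
    Submodule.sum_mem _ fun b hb => h.mem_Z hα (hS hb)
  constructor
  · rw [← LinearMap.ker_eq_bot, LinearMap.ker_eq_bot']
    intro c hc
    rw [barMap_apply] at hc
    let T : Finset (Fin D.births.card) := Finset.univ.filter fun k => (c k : ZMod 2) ≠ 0
    have hT : T.image (fun k => (D.birthEquiv k : ℕ)) ⊆ D.alive d α := by
      intro b hb
      obtain ⟨k, hk, rfl⟩ := Finset.mem_image.1 hb
      rw [mem_alive_birthEquiv]
      by_contra h1
      refine (Finset.mem_filter.1 hk).2 ?_
      rw [ZigzagModule.intervalSpace_eq_zero h1 (c k)]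
      rfl
    have h1 : ∑ b ∈ T.image (fun k => (D.birthEquiv k : ℕ)), barVector cls d J α b = 0 := by
      rw [Finset.sum_image fun x _ y _ hxy => D.birthEquiv.injective (Subtype.ext hxy), ← hc,
        Finset.sum_filter]
      refine Finset.sum_congr rfl fun k _ => ?_
      have : ∀ a : ZMod 2, a = 0 ∨ a = 1 := by decide
      rcases this (c k) with h2 | h2 <;> simp [h2]
    rw [← h.cls_sum hα hT (hsum _ hT), hM.eq_zero_iff] at h1
    have h2 := hbasis.indep _ hT h1
    rw [Finset.image_eq_empty, Finset.filter_eq_empty_iff] at h2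
    funext k
    exact Subtype.ext (not_not.1 (h2 (Finset.mem_univ k)))
  · intro y
    obtain ⟨x, rfl⟩ := hM.surjective α y
    obtain ⟨S, hS, hxS⟩ := hbasis.span x x.2
    let c : ∀ k, ZigzagModule.intervalSpace (D.bars d k).1 (D.bars d k).2 α := fun k =>
      if (D.birthEquiv k : ℕ) ∈ S then ZigzagModule.intervalUnit _ _ α else 0
    refine ⟨c, ?_⟩
    have h1 : cls α x = cls α ⟨∑ b ∈ S, D.z (J b) α, hsum S hS⟩ := hM.eq_of_add_mem hxS
    rw [h1, h.cls_sum hα hS, barMap_apply]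
    have h2 : S = (Finset.univ.filter fun k => (D.birthEquiv k : ℕ) ∈ S).image
        fun k => (D.birthEquiv k : ℕ) := by
      ext b
      simp only [Finset.mem_image, Finset.mem_filter, Finset.mem_univ, true_and]
      constructor
      · intro hb
        refine ⟨D.birthEquiv.symm ⟨b, (mem_alive.1 (hS hb)).1⟩, ?_, ?_⟩ <;> simp [hb]
      · rintro ⟨k, hk, rfl⟩
        exact hk
    conv_rhs => rw [h2]
    rw [Finset.sum_image fun x _ y _ hxy => D.birthEquiv.injective (Subtype.ext hxy),
      Finset.sum_filter]
    refine Finset.sum_congr rfl fun k _ => ?_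
    by_cases h3 : (D.birthEquiv k : ℕ) ∈ S
    · have h4 := mem_alive_birthEquiv.1 (hS h3)
      simp [c, h3, ZigzagModule.coe_intervalUnit h4]
    · simp [c, h3]

theorem IsState.barMap_forward (hM : D.Presents M cls) (h : D.IsState m d J) (i : ℕ)
    (hi : i < m) (hf : fwd i)
    (c : ∀ k, ZigzagModule.intervalSpace (D.bars d k).1 (D.bars d k).2 i) :
    barMap cls d J (i + 1) (fun k => ZigzagModule.intervalMap _ _ i (i + 1) (c k)) =
      M.forward i hi hf (barMap cls d J i c) := by
  rw [barMap_apply, barMap_apply, map_sum]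
  refine Finset.sum_congr rfl fun k _ => ?_
  rw [map_smul]
  by_cases h1 : (D.birthEquiv k : ℕ) ∈ D.alive d i
  · rw [h.forward_barVector hM hi hf h1]
    by_cases h2 : (D.birthEquiv k : ℕ) ∈ D.alive d (i + 1)
    · rw [ZigzagModule.coe_intervalMap (mem_alive_birthEquiv.1 h2)]
    · rw [barVector_of_notMem h2, smul_zero, smul_zero]
  · rw [ZigzagModule.intervalSpace_eq_zero (mt mem_alive_birthEquiv.2 h1) (c k)]
    simp

theorem IsState.barMap_backward (hM : D.Presents M cls) (h : D.IsState m d J) (i : ℕ)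
    (hi : i < m) (hf : ¬ fwd i)
    (c : ∀ k, ZigzagModule.intervalSpace (D.bars d k).1 (D.bars d k).2 (i + 1)) :
    barMap cls d J i (fun k => ZigzagModule.intervalMap _ _ (i + 1) i (c k)) =
      M.backward i hi hf (barMap cls d J (i + 1) c) := by
  rw [barMap_apply, barMap_apply, map_sum]
  refine Finset.sum_congr rfl fun k _ => ?_
  rw [map_smul]
  by_cases h1 : (D.birthEquiv k : ℕ) ∈ D.alive d (i + 1)
  · rw [h.backward_barVector hM hi hf h1]
    by_cases h2 : (D.birthEquiv k : ℕ) ∈ D.alive d i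
    · rw [ZigzagModule.coe_intervalMap (mem_alive_birthEquiv.1 h2)]
    · rw [barVector_of_notMem h2, smul_zero, smul_zero]
  · rw [ZigzagModule.intervalSpace_eq_zero (mt mem_alive_birthEquiv.2 h1) (c k)]
    simp

/-- The bars of a state at the last index form the barcode. -/
theorem IsState.isBarcode (hM : D.Presents M cls) (h : D.IsState m d J) :
    M.IsBarcode (D.births.val.map fun b => (b, d b)) := by
  refine ⟨_, D.bars d, ?_, fun k => ?_, ⟨ZigzagModule.Iso.symm ?_⟩⟩
  · have h1 : D.births.val = Finset.univ.val.map fun k => (D.birthEquiv k : ℕ) := by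
      have h2 : (Finset.univ : Finset (Fin D.births.card)).map
          (D.birthEquiv.toEmbedding.trans (Function.Embedding.subtype _)) = D.births := by
        ext b
        simp only [Finset.mem_map, Finset.mem_univ, true_and]
        constructor
        · rintro ⟨k, rfl⟩
          exact (D.birthEquiv k).2
        · intro hb
          exact ⟨D.birthEquiv.symm ⟨b, hb⟩, by simp⟩
      conv_lhs => rw [← h2]
      rfl
    rw [h1, Multiset.map_map]
    rfl
  · have hb := (D.birthEquiv k).2
    obtain ⟨j, hj, -, hjb⟩ := D.mem_births.1 hb
    have hbm : (D.birthEquiv k : ℕ) ≤ m := by omega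
    obtain ⟨p, hp⟩ := h.bar _ hb hbm
    exact ⟨hp.le, h.le _ hb hbm⟩
  · refine ⟨fun i hi => LinearEquiv.ofBijective _ (h.barMap_bijective hM hi),
      h.barMap_forward hM, h.barMap_backward hM⟩

/-- This accounts for the copies of `m` among the deaths: the bars open at the last index form a
basis of the last space. -/
theorem IsState.card_alive (hM : D.Presents M cls) (h : D.IsState m d J) :
    (D.alive d m).card = Module.finrank (ZMod 2) (M.X m) := by
  classical
  rw [← (LinearEquiv.ofBijective _ (h.barMap_bijective hM le_rfl)).finrank_eq,
    Module.finrank_pi_fintype]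
  have h1 : ∀ k, Module.finrank (ZMod 2)
      (ZigzagModule.intervalSpace (D.bars d k).1 (D.bars d k).2 m) =
        if (D.birthEquiv k : ℕ) ∈ D.alive d m then 1 else 0 := by
    intro k
    simp only [mem_alive_birthEquiv]
    by_cases h2 : (D.bars d k).1 ≤ m ∧ m ≤ (D.bars d k).2
    · rw [if_pos h2, ZigzagModule.intervalSpace_of_mem h2, finrank_top, Module.finrank_self]
    · rw [if_neg h2]
      rw [ZigzagModule.intervalSpace_of_notMem h2, finrank_bot]
  rw [Finset.sum_congr rfl fun k _ => h1 k,
    D.birthEquiv.sum_comp (fun b => if (b : ℕ) ∈ D.alive d m then 1 else 0),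
    ← Finset.sum_subtype D.births (fun _ => Iff.rfl) (fun b => if b ∈ D.alive d m then 1 else 0),
    ← Finset.card_filter]
  congr 1
  ext b
  rw [Finset.mem_filter, mem_alive]
  tauto

open Classical in
/-- The right endpoints of the bars of a state at the last index. -/
theorem IsState.map_death (hM : D.Presents M cls) (h : D.IsState m d J) :
    D.births.val.map d = ((Finset.range m).filter D.DeathAt).val +
      Multiset.replicate (Module.finrank (ZMod 2) (M.X m)) m := by
  have hbm : ∀ b ∈ D.births, b ≤ m := by
    intro b hb
    obtain ⟨j, hj, -, rfl⟩ := D.mem_births.1 hb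
    exact hj
  rw [← h.card_alive hM]
  ext j
  rw [Multiset.count_add, Multiset.count_replicate, Multiset.count_map]
  change (D.births.filter fun b => j = d b).card + 0 = _
  rw [add_zero]
  by_cases hjm : m = j
  · subst hjm
    rw [if_pos rfl, Multiset.count_eq_zero_of_notMem (by simp), zero_add]
    congr 1
    ext b
    rw [Finset.mem_filter, mem_alive]
    refine and_congr_right fun hb => ?_
    have h1 := hbm b hb
    have h2 := h.le b hb h1
    omega
  · rw [if_neg hjm, add_zero]
    by_cases hD : j < m ∧ D.DeathAt j
    · obtain ⟨b, hb⟩ := h.unique j hD.1 hD.2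
      rw [Multiset.count_eq_one_of_mem (Finset.nodup _) (by simpa using hD), Finset.card_eq_one]
      refine ⟨b, ?_⟩
      ext b'
      rw [Finset.mem_filter, Finset.mem_singleton, ← hb b']
      exact ⟨fun h1 => ⟨h1.1, hbm _ h1.1, h1.2.symm⟩, fun h1 => ⟨h1.1, h1.2.2.symm⟩⟩
    · rw [Multiset.count_eq_zero_of_notMem (by simpa using hD), Finset.card_eq_zero,
        Finset.filter_eq_empty_iff]
      rintro b hb rfl
      have h1 := h.le b hb (hbm b hb)
      have h2 : d b < m := by omega
      exact hD ⟨h2, (h.dies b hb (hbm b hb) h2).imp And.left And.left⟩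

end Vectors

end PairZigzag

end WireZigzag

end

/-! ### Chains, degrees and the effect of adding one simplex. -/

noncomputable section

namespace WireZigzag

section Simplicial

variable {V : Type*}

open Classical in
/-- The chain of a simplex, and zero for the empty set. -/
def simplexChain (τ : Finset V) : Chain V := if τ.Nonempty then Finsupp.single τ 1 else 0

open Classical in
theorem powersetCard_card_sub_one {σ : Finset V} (hσ : σ.Nonempty) :
    σ.powersetCard (σ.card - 1) = σ.image σ.erase := by
  ext τ
  rw [Finset.mem_powersetCard, Finset.mem_image]
  have hpos := hσ.card_pos
  constructor
  · rintro ⟨h1, h2⟩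
    have h3 : (σ \ τ).card = 1 := by
      rw [Finset.card_sdiff_of_subset h1]
      omega
    obtain ⟨x, hx⟩ := Finset.card_eq_one.1 h3
    have hx' : x ∈ σ \ τ := hx ▸ Finset.mem_singleton_self x
    refine ⟨x, (Finset.mem_sdiff.1 hx').1, ?_⟩
    rw [← Finset.sdiff_singleton_eq_erase, ← hx, Finset.sdiff_sdiff_eq_self h1]
  · rintro ⟨x, hx, rfl⟩
    exact ⟨Finset.erase_subset _ _, Finset.card_erase_of_mem hx⟩

open Classical in
theorem boundaryMap_single (σ : Finset V) :
    boundaryMap V (Finsupp.single σ 1) = ∑ x ∈ σ, simplexChain (σ.erase x) := by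
  rw [boundaryMap, Finsupp.linearCombination_single, one_smul]
  rcases σ.eq_empty_or_nonempty with rfl | hσ
  · rw [Finset.sum_empty, Finset.filter_false_of_mem, Finset.sum_empty]
    intro τ hτ
    have h1 := Finset.subset_empty.1 (Finset.mem_powersetCard.1 hτ).1
    simp [h1]
  · rw [powersetCard_card_sub_one hσ, Finset.sum_filter, Finset.sum_image (Finset.erase_injOn σ)]
    rfl

open Classical in
theorem boundaryMap_simplexChain (σ : Finset V) :
    boundaryMap V (simplexChain σ) = ∑ x ∈ σ, simplexChain (σ.erase x) := by
  rw [← boundaryMap_single, simplexChain]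
  split_ifs with h
  · rfl
  · rw [Finset.not_nonempty_iff_eq_empty] at h
    subst h
    rw [map_zero, boundaryMap_single, Finset.sum_empty]

theorem boundaryMap_boundaryMap (x : Chain V) : boundaryMap V (boundaryMap V x) = 0 := by
  classical
  suffices h : boundaryMap V ∘ₗ boundaryMap V = 0 from LinearMap.congr_fun h x
  refine Finsupp.lhom_ext' fun σ => LinearMap.ext_ring ?_
  change boundaryMap V (boundaryMap V (Finsupp.single σ 1)) = 0
  rw [boundaryMap_single, map_sum, Finset.sum_congr rfl fun x _ => boundaryMap_simplexChain _,
    Finset.sum_sigma']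
  -- The two orders of removing a pair of vertices give the same face and cancel modulo two.
  refine Finset.sum_involution (fun p _ => ⟨p.2, p.1⟩) ?_ ?_ ?_ ?_
  · rintro ⟨x, y⟩ -
    simp only
    rw [Finset.erase_right_comm, ZModModule.add_self]
  · rintro ⟨x, y⟩ h - h2
    simp only [Finset.mem_sigma, Finset.mem_erase] at h
    simp only [Sigma.mk.injEq] at h2
    exact h.2.1 h2.1
  · rintro ⟨x, y⟩ h
    simp only [Finset.mem_sigma, Finset.mem_erase] at h ⊢
    exact ⟨h.2.2, h.2.1.symm, h.1⟩
  · rintro ⟨x, y⟩ -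
    rfl

/-- The part of a chain on the sets with `s` elements. -/
def cardPart (V : Type*) (s : ℕ) : Chain V →ₗ[ZMod 2] Chain V where
  toFun := Finsupp.filter fun σ => σ.card = s
  map_add' _ _ := Finsupp.filter_add
  map_smul' _ _ := Finsupp.filter_smul

theorem cardPart_apply (s : ℕ) (x : Chain V) (σ : Finset V) :
    cardPart V s x σ = if σ.card = s then x σ else 0 :=
  Finsupp.filter_apply _ _ _

theorem cardPart_of_mem {p : ℕ} {x : Chain V} (hx : x ∈ chainsOfDim V p) :
    cardPart V (p + 1) x = x := by
  ext σ
  rw [cardPart_apply]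
  split_ifs with h
  · rfl
  · exact ((Finsupp.mem_supported' _ _).1 hx σ h).symm

theorem cardPart_of_ne {p q : ℕ} (hpq : q ≠ p) {x : Chain V} (hx : x ∈ chainsOfDim V q) :
    cardPart V (p + 1) x = 0 := by
  ext σ
  rw [cardPart_apply]
  split_ifs with h
  · exact (Finsupp.mem_supported' _ _).1 hx σ fun h1 => hpq (by
      have : σ.card = q + 1 := h1
      omega)
  · rfl

theorem cardPart_mem (p : ℕ) (x : Chain V) : cardPart V (p + 1) x ∈ chainsOfDim V p := by
  refine (Finsupp.mem_supported' _ _).2 fun σ h => ?_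
  rw [cardPart_apply]
  exact if_neg h

theorem cardPart_simplexChain (s : ℕ) (σ : Finset V) :
    cardPart V s (simplexChain σ) = if σ.card = s then simplexChain σ else 0 := by
  ext τ
  rw [cardPart_apply, simplexChain]
  by_cases h : σ = τ
  · subst h
    split_ifs <;> rfl
  · split_ifs <;> simp [h]

/-- This also holds for `s = 0`: the boundary omits the empty face, so both sides vanish. -/
theorem boundaryMap_cardPart (s : ℕ) (x : Chain V) :
    boundaryMap V (cardPart V (s + 1) x) = cardPart V s (boundaryMap V x) := by
  classical
  suffices h : boundaryMap V ∘ₗ cardPart V (s + 1) = cardPart V s ∘ₗ boundaryMap V from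
    LinearMap.congr_fun h x
  refine Finsupp.lhom_ext' fun σ => LinearMap.ext_ring ?_
  change boundaryMap V (cardPart V (s + 1) (Finsupp.single σ 1)) =
    cardPart V s (boundaryMap V (Finsupp.single σ 1))
  rw [boundaryMap_single, map_sum]
  by_cases h : σ.card = s + 1
  · have h1 : cardPart V (s + 1) (Finsupp.single σ 1) = Finsupp.single σ 1 :=
      cardPart_of_mem (Finsupp.single_mem_supported _ _ h)
    rw [h1, boundaryMap_single]
    refine Finset.sum_congr rfl fun x hx => ?_
    rw [cardPart_simplexChain, if_pos (by rw [Finset.card_erase_of_mem hx, h]; rfl)]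
  · have h1 : cardPart V (s + 1) (Finsupp.single σ 1) = 0 := by
      ext τ
      rw [cardPart_apply, Finsupp.single_apply]
      split_ifs with h2 h3
      · exact absurd (h3 ▸ h2) h
      · rfl
      · rfl
    rw [h1, map_zero]
    refine (Finset.sum_eq_zero fun x hx => ?_).symm
    have h2 := Finset.card_pos.2 ⟨x, hx⟩
    rw [cardPart_simplexChain, if_neg (by rw [Finset.card_erase_of_mem hx]; omega)]

variable {K L : PreAbstractSimplicialComplex V}

theorem mem_chainGroup {x : Chain V} : x ∈ chainGroup K ↔ ∀ σ ∉ K.faces, x σ = 0 :=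
  Finsupp.mem_supported' _ _

theorem cardPart_mem_chainGroup (s : ℕ) {x : Chain V} (hx : x ∈ chainGroup K) :
    cardPart V s x ∈ chainGroup K := by
  rw [mem_chainGroup] at hx ⊢
  intro σ hσ
  rw [cardPart_apply, hx σ hσ, ite_self]

theorem cardPart_mem_boundaryGroup (s : ℕ) {x : Chain V} (hx : x ∈ boundaryGroup K) :
    cardPart V s x ∈ boundaryGroup K := by
  obtain ⟨y, hy, rfl⟩ := hx
  exact ⟨_, cardPart_mem_chainGroup (s + 1) hy, boundaryMap_cardPart s y⟩

theorem boundaryMap_single_mem {σ : Finset V}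
    (h : ∀ τ ⊆ σ, τ ≠ σ → τ.Nonempty → τ ∈ K.faces) :
    boundaryMap V (Finsupp.single σ 1) ∈ chainGroup K := by
  classical
  rw [boundaryMap_single]
  refine Submodule.sum_mem _ fun x hx => ?_
  rw [simplexChain]
  split_ifs with h1
  · exact Finsupp.single_mem_supported _ _
      (h _ (Finset.erase_subset _ _) (Finset.erase_ne_self.2 hx) h1)
  · exact Submodule.zero_mem _

theorem boundaryMap_mem {x : Chain V} (hx : x ∈ chainGroup K) :
    boundaryMap V x ∈ chainGroup K := by
  rw [← Finsupp.sum_single x, Finsupp.sum, map_sum]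
  refine Submodule.sum_mem _ fun σ hσ => ?_
  have h1 : Finsupp.single σ (x σ) = x σ • (Finsupp.single σ 1 : Chain V) := by simp
  rw [h1, map_smul]
  refine Submodule.smul_mem _ _ (boundaryMap_single_mem fun τ hτ _ hne => ?_)
  exact (K.isRelLowerSet_faces (hx hσ)).2 hτ hne

theorem boundaryGroup_le_cycleGroup (K : PreAbstractSimplicialComplex V) :
    boundaryGroup K ≤ cycleGroup K := by
  rintro _ ⟨x, hx, rfl⟩
  exact ⟨boundaryMap_mem hx, boundaryMap_boundaryMap x⟩

theorem homologyClass_eq_zero_iff {x : Chain V} (hx : x ∈ cycleGroup K) :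
    homologyClass K x hx = 0 ↔ x ∈ boundaryGroup K :=
  Submodule.Quotient.mk_eq_zero (boundariesInCycles K)

/-- `L` arises from `K` by the addition of the simplex `σ`. -/
structure Adds (K L : PreAbstractSimplicialComplex V) (σ : Finset V) : Prop where
  notMem : σ ∉ K.faces
  eq : L.faces = insert σ K.faces

namespace Adds

variable {σ : Finset V}

theorem subset (h : Adds K L σ) : K.faces ⊆ L.faces := h.eq ▸ Set.subset_insert _ _

theorem nonempty (h : Adds K L σ) : σ.Nonempty :=
  (L.isRelLowerSet_faces (h.eq ▸ Set.mem_insert σ K.faces : σ ∈ L.faces)).1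

theorem single_mem (h : Adds K L σ) : Finsupp.single σ 1 ∈ chainGroup L :=
  Finsupp.single_mem_supported _ _ (h.eq ▸ Set.mem_insert σ K.faces)

theorem mem_iff (h : Adds K L σ) {x : Chain V} (hx : x ∈ chainGroup L) :
    x ∈ chainGroup K ↔ x σ = 0 := by
  rw [mem_chainGroup] at hx ⊢
  refine ⟨fun h1 => h1 σ h.notMem, fun h1 τ hτ => ?_⟩
  by_cases h2 : τ = σ
  · rw [h2, h1]
  · exact hx τ (by rw [h.eq]; exact fun h3 => h3.elim h2 hτ)

theorem add_mem (h : Adds K L σ) {x y : Chain V} (hx : x ∈ chainGroup L) (hy : y ∈ chainGroup L)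
    (hx' : x ∉ chainGroup K) (hy' : y ∉ chainGroup K) : x + y ∈ chainGroup K := by
  have h2 : ∀ a b : ZMod 2, a ≠ 0 → b ≠ 0 → a + b = 0 := by decide
  rw [h.mem_iff hx] at hx'
  rw [h.mem_iff hy] at hy'
  rw [h.mem_iff (Submodule.add_mem _ hx hy)]
  exact h2 _ _ hx' hy'

theorem single_notMem (h : Adds K L σ) : (Finsupp.single σ 1 : Chain V) ∉ chainGroup K := by
  rw [h.mem_iff h.single_mem]
  simp

theorem codimLeOne_cycleGroup (h : Adds K L σ) :
    CodimLeOne (cycleGroup K) (cycleGroup L) := by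
  intro x hx y hy hx' hy'
  refine ⟨h.add_mem hx.1 hy.1 (fun h1 => hx' ⟨h1, hx.2⟩) (fun h1 => hy' ⟨h1, hy.2⟩), ?_⟩
  exact Submodule.add_mem _ hx.2 hy.2

theorem codimLeOne_boundaryGroup (h : Adds K L σ) :
    CodimLeOne (boundaryGroup K) (boundaryGroup L) := by
  rintro _ ⟨x, hx, rfl⟩ _ ⟨y, hy, rfl⟩ hx' hy'
  exact ⟨x + y, h.add_mem hx hy (fun h1 => hx' ⟨x, h1, rfl⟩) (fun h1 => hy' ⟨y, h1, rfl⟩),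
    map_add _ _ _⟩

/-- A chain of `L` outside `C(K)` is `σ` plus a chain of `K`, so `∂σ` is the only possible new
generator of the boundaries. -/
theorem boundaryGroup_le_iff (h : Adds K L σ) :
    boundaryGroup L ≤ boundaryGroup K ↔
      boundaryMap V (Finsupp.single σ 1) ∈ boundaryGroup K := by
  refine ⟨fun h1 => h1 ⟨_, h.single_mem, rfl⟩, ?_⟩
  rintro h1 _ ⟨x, hx, rfl⟩
  by_cases hxK : x ∈ chainGroup K
  · exact ⟨x, hxK, rfl⟩
  · refine ((boundaryGroup K).add_mem_iff_left h1).1 ?_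
    exact ⟨_, h.add_mem hx h.single_mem hxK h.single_notMem, map_add _ _ _⟩

/-- A new cycle would contain `σ`, and its remaining part would be a chain of `K` with boundary
`∂σ`. -/
theorem cycleGroup_le (h : Adds K L σ) (hB : ¬ boundaryGroup L ≤ boundaryGroup K) :
    cycleGroup L ≤ cycleGroup K := by
  intro x hx
  by_contra hxK
  rw [h.boundaryGroup_le_iff] at hB
  refine hB ⟨_, h.add_mem hx.1 h.single_mem (fun h1 => hxK ⟨h1, hx.2⟩) h.single_notMem, ?_⟩
  rw [map_add, LinearMap.mem_ker.1 hx.2, zero_add]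

theorem exists_boundary (h : Adds K L σ) (hB : ¬ boundaryGroup L ≤ boundaryGroup K) :
    ∃ u, u ∈ boundaryGroup L ∧ u ∉ boundaryGroup K ∧ ∃ p, u ∈ chainsOfDim V p := by
  classical
  -- The witness is `∂σ`. Truncated subtraction does no harm, since only nonempty faces contribute.
  refine ⟨_, ⟨_, h.single_mem, rfl⟩, mt h.boundaryGroup_le_iff.2 hB, σ.card - 2, ?_⟩
  rw [boundaryMap_single]
  refine Submodule.sum_mem _ fun x hx => ?_
  rw [simplexChain]
  split_ifs with h1
  · refine Finsupp.single_mem_supported _ _ ?_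
    have h2 := h1.card_pos
    rw [Set.mem_ofPred_eq]
    rw [Finset.card_erase_of_mem hx] at h2 ⊢
    omega
  · exact Submodule.zero_mem _

theorem exists_cycle (h : Adds K L σ) (hB : boundaryGroup L ≤ boundaryGroup K) :
    ∃ w, w ∈ cycleGroup L ∧ w ∉ cycleGroup K ∧ ∃ p, w ∈ chainsOfDim V p := by
  obtain ⟨p, hp⟩ : ∃ p, σ.card = p + 1 := ⟨σ.card - 1, by have := h.nonempty.card_pos; omega⟩
  obtain ⟨x, hx, hxσ⟩ := h.boundaryGroup_le_iff.1 hB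
  have h1 : (Finsupp.single σ 1 : Chain V) ∈ chainsOfDim V p :=
    Finsupp.single_mem_supported _ _ hp
  have h2 := cardPart_mem_chainGroup (p + 1) hx
  -- The chain `x` of `K` has boundary `∂σ`, so `σ + x` is a cycle; restricting `x` to the dimension
  -- of `σ` keeps this and makes the cycle homogeneous.
  refine ⟨Finsupp.single σ 1 + cardPart V (p + 1) x, ⟨?_, ?_⟩, fun h3 => ?_, p, ?_⟩
  · exact Submodule.add_mem _ h.single_mem (chainGroup_mono h.subset h2)
  · change boundaryMap V _ = 0
    rw [map_add, boundaryMap_cardPart, hxσ, ← boundaryMap_cardPart,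
      cardPart_of_mem h1, ZModModule.add_self]
  · exact h.single_notMem (((chainGroup K).add_mem_iff_left h2).1 h3.1)
  · exact Submodule.add_mem _ h1 (cardPart_mem p x)

theorem exists_dim_cycleGroup (h : Adds K L σ) :
    ∃ p, ∀ q, q ≠ p → ∀ x ∈ cycleGroup L, x ∈ chainsOfDim V q → x ∈ cycleGroup K := by
  refine ⟨σ.card - 1, fun q hq x hx hxq => ⟨(h.mem_iff hx.1).2 ?_, hx.2⟩⟩
  refine (Finsupp.mem_supported' _ _).1 hxq σ fun h1 => hq ?_
  rw [Set.mem_ofPred_eq] at h1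
  omega

/-- A boundary of degree `q` is the boundary of the part of its filling on sets with `q + 2`
elements, and this part avoids `σ` unless `q` is the degree of `∂σ`. -/
theorem exists_dim_boundaryGroup (h : Adds K L σ) :
    ∃ p, ∀ q, q ≠ p → ∀ x ∈ boundaryGroup L, x ∈ chainsOfDim V q → x ∈ boundaryGroup K := by
  refine ⟨σ.card - 2, ?_⟩
  rintro q hq _ ⟨x, hx, rfl⟩ hxq
  rw [← cardPart_of_mem hxq, ← boundaryMap_cardPart]
  refine ⟨_, (h.mem_iff (cardPart_mem_chainGroup _ hx)).2 ?_, rfl⟩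
  rw [cardPart_apply, if_neg (by omega)]

theorem injective_homologyMap_iff (h : Adds K L σ) :
    Function.Injective (homologyMap h.subset) ↔ boundaryGroup L ≤ boundaryGroup K := by
  rw [← LinearMap.ker_eq_bot, LinearMap.ker_eq_bot']
  constructor
  · intro hinj
    by_contra hB
    obtain ⟨u, hu1, hu2, -⟩ := h.exists_boundary hB
    have hu : u ∈ cycleGroup K := h.cycleGroup_le hB (boundaryGroup_le_cycleGroup L hu1)
    refine hu2 ?_
    exact (homologyClass_eq_zero_iff hu).1 (hinj (homologyClass K u hu)
      ((homologyClass_eq_zero_iff (cycleGroup_mono h.subset hu)).2 hu1))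
  · intro hB y hy
    obtain ⟨x, rfl⟩ := Submodule.Quotient.mk_surjective _ y
    exact (homologyClass_eq_zero_iff x.2).2
      (hB ((homologyClass_eq_zero_iff (cycleGroup_mono h.subset x.2)).1 hy))

/-- If `B` is unchanged, a new cycle is not homologous to any cycle of `K`; if `B` grows, there are
no new cycles. -/
theorem surjective_homologyMap_iff (h : Adds K L σ) :
    Function.Surjective (homologyMap h.subset) ↔ ¬ boundaryGroup L ≤ boundaryGroup K := by
  constructor
  · intro hs hB
    obtain ⟨w, hw1, hw2, -⟩ := h.exists_cycle hB
    obtain ⟨y, hy⟩ := hs (homologyClass L w hw1)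
    obtain ⟨x, rfl⟩ := Submodule.Quotient.mk_surjective _ y
    have h1 : (x : Chain V) - w ∈ boundaryGroup L :=
      (Submodule.Quotient.eq (boundariesInCycles L)).1 hy
    have h2 := boundaryGroup_le_cycleGroup K (hB h1)
    exact hw2 (by simpa using (cycleGroup K).sub_mem x.2 h2)
  · intro hB y
    obtain ⟨x, rfl⟩ := Submodule.Quotient.mk_surjective _ y
    exact ⟨homologyClass K x (h.cycleGroup_le hB x.2), rfl⟩

theorem surjective_boundaryInclusion_iff (h : Adds K L σ) :
    Function.Surjective (boundaryInclusion h.subset) ↔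
      boundaryGroup L ≤ boundaryGroup K := by
  constructor
  · intro hs x hx
    obtain ⟨y, hy⟩ := hs ⟨x, hx⟩
    have h1 : (y : Chain V) = x := congrArg Subtype.val hy
    exact h1 ▸ y.2
  · exact fun hB y => ⟨⟨y, hB y.2⟩, rfl⟩

end Adds

end Simplicial

end WireZigzag

end

/-! ### The homology and boundary zigzags of a filtration. -/

noncomputable section

namespace WireZigzag

namespace Filtration

variable {V : Type*} {m : ℕ} (F : Filtration V m)

theorem exists_adds_of_forward {i : ℕ} (hi : i < m) (hf : F.Forward i) :
    ∃ σ, Adds (F.K i) (F.K (i + 1)) σ := by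
  rcases F.step i hi with ⟨σ, h1, h2⟩ | ⟨σ, h1, h2⟩
  · exact ⟨σ, h1, h2⟩
  · exact absurd (hf (h2 ▸ Set.mem_insert σ _)) h1

theorem exists_adds_of_not_forward {i : ℕ} (hi : i < m) (hf : ¬ F.Forward i) :
    ∃ σ, Adds (F.K (i + 1)) (F.K i) σ := by
  rcases F.step i hi with ⟨σ, h1, h2⟩ | ⟨σ, h1, h2⟩
  · exact absurd (show (F.K i).faces ⊆ (F.K (i + 1)).faces from h2 ▸ Set.subset_insert _ _) hf
  · exact ⟨σ, h1, h2⟩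

/-- The boundary groups at the two ends of the arrow `i` agree. -/
def BoundaryConst (i : ℕ) : Prop :=
  boundaryGroup (F.K (i + 1)) = boundaryGroup (F.K i)

variable {F} in
theorem boundaryConst_iff_of_forward {i : ℕ} (hf : F.Forward i) :
    F.BoundaryConst i ↔ boundaryGroup (F.K (i + 1)) ≤ boundaryGroup (F.K i) :=
  ⟨le_of_eq, fun h => le_antisymm h (boundaryGroup_mono hf)⟩

theorem boundaryConst_iff_of_not_forward {i : ℕ} (hi : i < m) (hf : ¬ F.Forward i) :
    F.BoundaryConst i ↔ boundaryGroup (F.K i) ≤ boundaryGroup (F.K (i + 1)) :=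
  ⟨ge_of_eq, fun h => le_antisymm (boundaryGroup_mono (F.subset_of_not_forward hi hf)) h⟩

/-- The chain `x` can serve as the wire at the index `i + 1`. -/
structure WireChoice (i : ℕ) (x : Chain V) : Prop where
  cycle : F.Forward i → F.BoundaryConst i →
    x ∈ cycleGroup (F.K (i + 1)) ∧ x ∉ cycleGroup (F.K i) ∧ ∃ p, x ∈ chainsOfDim V p
  boundary_forward : F.Forward i → ¬ F.BoundaryConst i →
    x ∈ boundaryGroup (F.K (i + 1)) ∧ x ∉ boundaryGroup (F.K i) ∧ ∃ p, x ∈ chainsOfDim V p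
  boundary_backward : ¬ F.Forward i → ¬ F.BoundaryConst i →
    x ∈ boundaryGroup (F.K i) ∧ x ∉ boundaryGroup (F.K (i + 1)) ∧ ∃ p, x ∈ chainsOfDim V p

/-- The conditions on a wire concern mutually exclusive kinds of arrows, so a single chain always
meets them all. -/
theorem exists_wireChoice {i : ℕ} (hi : i < m) : ∃ x, F.WireChoice i x := by
  by_cases hf : F.Forward i
  · obtain ⟨σ, hσ⟩ := F.exists_adds_of_forward hi hf
    by_cases hB : F.BoundaryConst i
    · obtain ⟨x, hx⟩ := hσ.exists_cycle hB.le
      exact ⟨x, fun _ _ => hx, fun _ h => absurd hB h, fun h => absurd hf h⟩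
    · obtain ⟨x, hx⟩ := hσ.exists_boundary (mt (boundaryConst_iff_of_forward hf).2 hB)
      exact ⟨x, fun _ h => absurd h hB, fun _ _ => hx, fun h => absurd hf h⟩
  · obtain ⟨σ, hσ⟩ := F.exists_adds_of_not_forward hi hf
    by_cases hB : F.BoundaryConst i
    -- Nothing is born at a backward arrow that keeps the boundaries, so any chain would do.
    · exact ⟨0, fun h => absurd h hf, fun h => absurd h hf, fun _ h => absurd hB h⟩
    · obtain ⟨x, hx⟩ := hσ.exists_boundary
        (mt (F.boundaryConst_iff_of_not_forward hi hf).2 hB)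
      exact ⟨x, fun h => absurd h hf, fun h => absurd h hf, fun _ _ => hx⟩

open Classical in
/-- The effect of the arrow `i` on homology. -/
def homologyKind (i : ℕ) : StepKind :=
  if F.Forward i then if F.BoundaryConst i then .birthForward else .deathForward
  else if F.BoundaryConst i then .deathBackward else .birthBackward

open Classical in
/-- The effect of the arrow `i` on the boundary groups. -/
def boundaryKind (i : ℕ) : StepKind :=
  if F.BoundaryConst i then .const else if F.Forward i then .birthForward else .deathBackward

theorem chainGroup_zero : chainGroup (F.K 0) = ⊥ := by
  rw [chainGroup, F.empty, Finsupp.supported_empty]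

theorem cycleGroup_zero : cycleGroup (F.K 0) = ⊥ :=
  eq_bot_iff.2 fun _ hx => F.chainGroup_zero ▸ hx.1

theorem boundaryGroup_zero : boundaryGroup (F.K 0) = ⊥ := by
  rw [boundaryGroup, F.chainGroup_zero, Submodule.map_bot]

/-- The zigzag of the pairs formed by the cycle and boundary groups. -/
def homologyPairs (w : ℕ → Chain V) (hw : ∀ i < m, F.WireChoice i (w (i + 1))) :
    PairZigzag V m F.Forward where
  Z i := cycleGroup (F.K i)
  B i := boundaryGroup (F.K i)
  G := chainsOfDim V
  proj p := cardPart V (p + 1)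
  w := w
  kind := F.homologyKind
  B_le i := boundaryGroup_le_cycleGroup _
  Z_zero := F.cycleGroup_zero
  proj_mem p _ _ hx := cardPart_mem_boundaryGroup (p + 1) hx
  proj_same _ _ hx := cardPart_of_mem hx
  proj_ne _ _ hpq _ hx := cardPart_of_ne hpq hx
  birthForward i hi hk := by
    unfold homologyKind at hk
    split_ifs at hk with hf hB
    obtain ⟨h1, h2, h3⟩ := (hw i hi).cycle hf hB
    obtain ⟨σ, hσ⟩ := F.exists_adds_of_forward hi hf
    exact ⟨hf, hB, cycleGroup_mono hf, h1, h2, h3, hσ.codimLeOne_cycleGroup⟩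
  birthBackward i hi hk := by
    unfold homologyKind at hk
    split_ifs at hk with hf hB hB
    obtain ⟨h1, h2, h3⟩ := (hw i hi).boundary_backward hf hB
    obtain ⟨σ, hσ⟩ := F.exists_adds_of_not_forward hi hf
    have hsub := F.subset_of_not_forward hi hf
    exact ⟨hf, le_antisymm (cycleGroup_mono hsub) (hσ.cycleGroup_le
      (mt (F.boundaryConst_iff_of_not_forward hi hf).2 hB)), boundaryGroup_mono hsub, h1, h2, h3,
      hσ.codimLeOne_boundaryGroup⟩
  deathForward i hi hk := by
    unfold homologyKind at hk
    split_ifs at hk with hf hB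
    obtain ⟨σ, hσ⟩ := F.exists_adds_of_forward hi hf
    have hB' := mt (boundaryConst_iff_of_forward hf).2 hB
    obtain ⟨u, h1, h2, p, hp⟩ := hσ.exists_boundary hB'
    exact ⟨hf, le_antisymm (hσ.cycleGroup_le hB') (cycleGroup_mono hf), boundaryGroup_mono hf,
      ⟨p, u, hp, h1, h2⟩, hσ.codimLeOne_boundaryGroup⟩
  deathBackward i hi hk := by
    unfold homologyKind at hk
    split_ifs at hk with hf hB hB
    obtain ⟨σ, hσ⟩ := F.exists_adds_of_not_forward hi hf
    obtain ⟨x, h1, h2, -⟩ := hσ.exists_cycle hB.ge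
    exact ⟨hf, hB, cycleGroup_mono (F.subset_of_not_forward hi hf), ⟨x, h1, h2⟩,
      hσ.exists_dim_cycleGroup, hσ.codimLeOne_cycleGroup⟩
  const i _ hk := by
    unfold homologyKind at hk
    split_ifs at hk

/-- The zigzag of the boundary groups, as pairs with the zero subspace. -/
def boundaryPairs (w : ℕ → Chain V) (hw : ∀ i < m, F.WireChoice i (w (i + 1))) :
    PairZigzag V m F.Forward where
  Z i := boundaryGroup (F.K i)
  -- With zero denominator, classes are the chains themselves, and compatibility along a bar becomes
  -- equality.
  B _ := ⊥
  G := chainsOfDim V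
  proj p := cardPart V (p + 1)
  w := w
  kind := F.boundaryKind
  B_le _ := bot_le
  Z_zero := F.boundaryGroup_zero
  proj_mem p _ x hx := by
    rw [Submodule.mem_bot] at hx ⊢
    rw [hx, map_zero]
  proj_same _ _ hx := cardPart_of_mem hx
  proj_ne _ _ hpq _ hx := cardPart_of_ne hpq hx
  birthForward i hi hk := by
    unfold boundaryKind at hk
    split_ifs at hk with hB hf
    obtain ⟨h1, h2, h3⟩ := (hw i hi).boundary_forward hf hB
    obtain ⟨σ, hσ⟩ := F.exists_adds_of_forward hi hf
    exact ⟨hf, rfl, boundaryGroup_mono hf, h1, h2, h3, hσ.codimLeOne_boundaryGroup⟩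
  birthBackward i _ hk := by
    unfold boundaryKind at hk
    split_ifs at hk
  deathForward i _ hk := by
    unfold boundaryKind at hk
    split_ifs at hk
  deathBackward i hi hk := by
    unfold boundaryKind at hk
    split_ifs at hk with hB hf
    obtain ⟨σ, hσ⟩ := F.exists_adds_of_not_forward hi hf
    obtain ⟨h1, h2, -⟩ := (hw i hi).boundary_backward hf hB
    exact ⟨hf, rfl, boundaryGroup_mono (F.subset_of_not_forward hi hf), ⟨_, h1, h2⟩,
      hσ.exists_dim_boundaryGroup, hσ.codimLeOne_boundaryGroup⟩
  const i _ hk := by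
    unfold boundaryKind at hk
    split_ifs at hk with hB
    exact ⟨hB, rfl⟩

theorem homology_injective_iff {i : ℕ} (hi : i < m) (hf : F.Forward i) :
    Function.Injective (F.homologyModule.forward i hi hf) ↔ F.BoundaryConst i := by
  obtain ⟨σ, hσ⟩ := F.exists_adds_of_forward hi hf
  rw [boundaryConst_iff_of_forward hf]
  exact hσ.injective_homologyMap_iff

theorem homology_surjective_iff {i : ℕ} (hi : i < m) (hf : ¬ F.Forward i) :
    Function.Surjective (F.homologyModule.backward i hi hf) ↔ ¬ F.BoundaryConst i := by
  obtain ⟨σ, hσ⟩ := F.exists_adds_of_not_forward hi hf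
  rw [F.boundaryConst_iff_of_not_forward hi hf]
  exact hσ.surjective_homologyMap_iff

theorem boundary_forward_surjective_iff {i : ℕ} (hi : i < m) (hf : F.Forward i) :
    Function.Surjective (F.boundaryModule.forward i hi hf) ↔ F.BoundaryConst i := by
  obtain ⟨σ, hσ⟩ := F.exists_adds_of_forward hi hf
  rw [boundaryConst_iff_of_forward hf]
  exact hσ.surjective_boundaryInclusion_iff

theorem boundary_backward_surjective_iff {i : ℕ} (hi : i < m) (hf : ¬ F.Forward i) :
    Function.Surjective (F.boundaryModule.backward i hi hf) ↔ F.BoundaryConst i := by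
  obtain ⟨σ, hσ⟩ := F.exists_adds_of_not_forward hi hf
  rw [F.boundaryConst_iff_of_not_forward hi hf]
  exact hσ.surjective_boundaryInclusion_iff

section Births

variable {w : ℕ → Chain V} (hw : ∀ i < m, F.WireChoice i (w (i + 1)))

theorem homologyPairs_birthAt {i : ℕ} :
    (F.homologyPairs w hw).BirthAt i ↔
      (F.Forward i ∧ F.BoundaryConst i) ∨ (¬ F.Forward i ∧ ¬ F.BoundaryConst i) := by
  change F.homologyKind i = _ ∨ F.homologyKind i = _ ↔ _
  unfold homologyKind
  split_ifs with hf hB hB <;> simp [hf, hB]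

theorem homologyPairs_deathAt {i : ℕ} :
    (F.homologyPairs w hw).DeathAt i ↔
      (F.Forward i ∧ ¬ F.BoundaryConst i) ∨ (¬ F.Forward i ∧ F.BoundaryConst i) := by
  change F.homologyKind i = _ ∨ F.homologyKind i = _ ↔ _
  unfold homologyKind
  split_ifs with hf hB hB <;> simp [hf, hB]

theorem boundaryPairs_birthAt {i : ℕ} :
    (F.boundaryPairs w hw).BirthAt i ↔ F.Forward i ∧ ¬ F.BoundaryConst i := by
  change F.boundaryKind i = _ ∨ F.boundaryKind i = _ ↔ _
  unfold boundaryKind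
  split_ifs with hB hf <;> simp_all

theorem boundaryPairs_deathAt {i : ℕ} :
    (F.boundaryPairs w hw).DeathAt i ↔ ¬ F.Forward i ∧ ¬ F.BoundaryConst i := by
  change F.boundaryKind i = _ ∨ F.boundaryKind i = _ ↔ _
  unfold boundaryKind
  split_ifs with hB hf <;> simp_all

theorem homologyBirths_eq : F.homologyBirths = (F.homologyPairs w hw).births := by
  classical
  unfold homologyBirths PairZigzag.births
  congr 1
  refine Finset.filter_congr fun i hi => ?_
  have hi := Finset.mem_range.1 hi
  rw [homologyPairs_birthAt]
  simp only [hi, exists_true_left]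
  refine or_congr ⟨fun ⟨hf, h⟩ => ⟨hf, (F.homology_injective_iff hi hf).1 h⟩,
    fun ⟨hf, h⟩ => ⟨hf, (F.homology_injective_iff hi hf).2 h⟩⟩
    ⟨fun ⟨hf, h⟩ => ⟨hf, (F.homology_surjective_iff hi hf).1 h⟩,
    fun ⟨hf, h⟩ => ⟨hf, (F.homology_surjective_iff hi hf).2 h⟩⟩

theorem boundaryBirths_eq : F.boundaryBirths = (F.boundaryPairs w hw).births := by
  classical
  unfold boundaryBirths PairZigzag.births
  congr 1
  refine Finset.filter_congr fun i hi => ?_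
  have hi := Finset.mem_range.1 hi
  rw [boundaryPairs_birthAt]
  simp only [hi, exists_true_left]
  exact ⟨fun ⟨hf, h⟩ => ⟨hf, mt (F.boundary_forward_surjective_iff hi hf).2 h⟩,
    fun ⟨hf, h⟩ => ⟨hf, mt (F.boundary_forward_surjective_iff hi hf).1 h⟩⟩

open Classical in
theorem homologyDeaths_eq : F.homologyDeaths =
    ((Finset.range m).filter (F.homologyPairs w hw).DeathAt).val +
      Multiset.replicate (Module.finrank (ZMod 2) (Homology (F.K m))) m := by
  unfold homologyDeaths
  congr 2
  refine Finset.filter_congr fun i hi => ?_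
  have hi := Finset.mem_range.1 hi
  rw [homologyPairs_deathAt]
  simp only [hi, exists_true_left]
  refine or_congr ⟨fun ⟨hf, h⟩ => ⟨hf, mt (F.homology_injective_iff hi hf).2 h⟩,
    fun ⟨hf, h⟩ => ⟨hf, mt (F.homology_injective_iff hi hf).1 h⟩⟩
    ⟨fun ⟨hf, h⟩ => ⟨hf, not_not.1 (mt (F.homology_surjective_iff hi hf).2 h)⟩,
    fun ⟨hf, h⟩ => ⟨hf, fun hs => (F.homology_surjective_iff hi hf).1 hs h⟩⟩

open Classical in
theorem boundaryDeaths_eq : F.boundaryDeaths =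
    ((Finset.range m).filter (F.boundaryPairs w hw).DeathAt).val +
      Multiset.replicate (Module.finrank (ZMod 2) (boundaryGroup (F.K m))) m := by
  unfold boundaryDeaths
  congr 2
  refine Finset.filter_congr fun i hi => ?_
  have hi := Finset.mem_range.1 hi
  rw [boundaryPairs_deathAt]
  simp only [hi, exists_true_left]
  exact ⟨fun ⟨hf, h⟩ => ⟨hf, mt (F.boundary_backward_surjective_iff hi hf).2 h⟩,
    fun ⟨hf, h⟩ => ⟨hf, mt (F.boundary_backward_surjective_iff hi hf).1 h⟩⟩

theorem isWire (hw : ∀ i < m, F.WireChoice i (w (i + 1))) {i : ℕ}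
    (hi : i ∈ F.homologyBirths ∪ F.boundaryBirths) : F.IsWire i (w i) := by
  refine ⟨hi, ?_⟩
  rw [Finset.mem_union, F.homologyBirths_eq hw, F.boundaryBirths_eq hw] at hi
  rcases hi with hi | hi <;> obtain ⟨j, hj, hB, rfl⟩ := (PairZigzag.mem_births _).1 hi
  · rcases (F.homologyPairs_birthAt hw).1 hB with ⟨hf, hB⟩ | ⟨hf, hB⟩
    · obtain ⟨h1, h2, -⟩ := (hw j hj).cycle hf hB
      exact ⟨h1, j, rfl, Or.inl ⟨hf, h2⟩⟩
    · obtain ⟨h1, h2, -⟩ := (hw j hj).boundary_backward hf hB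
      obtain ⟨σ, hσ⟩ := F.exists_adds_of_not_forward hj hf
      exact ⟨hσ.cycleGroup_le (mt (F.boundaryConst_iff_of_not_forward hj hf).2 hB)
        (boundaryGroup_le_cycleGroup _ h1), j, rfl, Or.inr (Or.inl ⟨hf, h1, h2⟩)⟩
  · obtain ⟨hf, hB⟩ := (F.boundaryPairs_birthAt hw).1 hB
    obtain ⟨h1, h2, -⟩ := (hw j hj).boundary_forward hf hB
    exact ⟨boundaryGroup_le_cycleGroup _ h1, j, rfl, Or.inr (Or.inr ⟨hf, h1, h2⟩)⟩

/-- The class maps from cycles to homology. -/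
def homologyCls (i : ℕ) : (F.homologyPairs w hw).Z i →ₗ[ZMod 2] F.homologyModule.X i :=
  show cycleGroup (F.K i) →ₗ[ZMod 2] Homology (F.K i) from (boundariesInCycles (F.K i)).mkQ

/-- The boundary groups as quotients by the zero subspace. -/
def boundaryCls (i : ℕ) : (F.boundaryPairs w hw).Z i →ₗ[ZMod 2] F.boundaryModule.X i :=
  show boundaryGroup (F.K i) →ₗ[ZMod 2] boundaryGroup (F.K i) from LinearMap.id

theorem homologyPairs_presents :
    (F.homologyPairs w hw).Presents F.homologyModule (F.homologyCls hw) where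
  surjective i := Submodule.Quotient.mk_surjective (boundariesInCycles (F.K i))
  eq_zero_iff _ x := homologyClass_eq_zero_iff x.2
  forward _ _ _ _ _ _ := rfl
  backward _ _ _ _ _ _ := rfl

theorem boundaryPairs_presents :
    (F.boundaryPairs w hw).Presents F.boundaryModule (F.boundaryCls hw) where
  surjective _ := Function.surjective_id
  eq_zero_iff _ x := (Submodule.mk_eq_zero _ x.2).trans Iff.rfl
  forward _ _ _ _ _ _ := rfl
  backward _ _ _ _ _ _ := rfl

variable {F hw} {d : ℕ → ℕ} {J : ℕ → Finset ℕ} {b : ℕ}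

theorem isHomologyRep (h : (F.homologyPairs w hw).IsState m d J)
    (hb : b ∈ F.homologyBirths) (hd : d b ∈ F.homologyDeaths) :
    F.IsHomologyRep b (d b) (bundleSum w (J b)) := by
  have hbD : b ∈ (F.homologyPairs w hw).births := F.homologyBirths_eq hw ▸ hb
  have hbm : b ≤ m := by
    obtain ⟨j, hj, -, rfl⟩ := (PairZigzag.mem_births _).1 hbD
    exact hj
  obtain ⟨p, hp⟩ := h.bar b hbD hbm
  have hdm := h.le b hbD hbm
  exact {
    birth_mem := hb
    death_mem := hd
    birth_le_death := hp.le
    death_le := hdm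
    cycle := hp.cycle
    homogeneous := ⟨p, fun α _ _ => hp.mem_G⟩
    compat_forward := fun α hbα hαd hf => by
      -- Along a forward arrow the chains are even equal, not merely homologous.
      have h1 : bundleSum w (J b) (α + 1) = bundleSum w (J b) α :=
        hp.z_succ_of_fwd hbα (hαd.trans_le hdm) hf
      simp only [h1]
      rfl
    compat_backward := fun α hbα hαd hf =>
      (F.homologyPairs_presents hw).eq_of_add_mem (i := α)
        (x := ⟨bundleSum w (J b) (α + 1), cycleGroup_mono
          (F.subset_of_not_forward (hαd.trans_le hdm) hf) (hp.cycle _ (by omega) hαd)⟩)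
        (y := ⟨bundleSum w (J b) α, hp.cycle _ hbα hαd.le⟩)
        (hp.z_succ_add_mem hbα (hαd.trans_le hdm))
    birth_forward := by
      rintro j rfl hf
      exact hp.notMem_of_fwd hf
    birth_backward := by
      rintro j rfl hf
      obtain ⟨h1, h2⟩ := hp.mem_of_not_fwd hf
      exact ⟨mt (homologyClass_eq_zero_iff _).1 h2,
        (homologyClass_eq_zero_iff (boundaryGroup_le_cycleGroup _ h1)).2 h1⟩
    death_backward := fun hd hf => (h.dies b hbD hbm hd).of_not_fwd hd hf
    death_forward := fun hd hf => by
      obtain ⟨h1, h2⟩ := (h.dies b hbD hbm hd).of_fwd hd hf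
      exact ⟨mt (homologyClass_eq_zero_iff _).1 h2,
        (homologyClass_eq_zero_iff (boundaryGroup_le_cycleGroup _ h1)).2 h1⟩ }

theorem isBoundaryRep (h : (F.boundaryPairs w hw).IsState m d J)
    (hb : b ∈ F.boundaryBirths) (hd : d b ∈ F.boundaryDeaths) :
    F.IsBoundaryRep b (d b) (bundleSum w (J b)) := by
  have hbD : b ∈ (F.boundaryPairs w hw).births := F.boundaryBirths_eq hw ▸ hb
  have hbm : b ≤ m := by
    obtain ⟨j, hj, -, rfl⟩ := (PairZigzag.mem_births _).1 hbD
    exact hj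
  obtain ⟨p, hp⟩ := h.bar b hbD hbm
  have hdm := h.le b hbD hbm
  exact {
    birth_mem := hb
    death_mem := hd
    birth_le_death := hp.le
    death_le := hdm
    boundary := hp.cycle
    homogeneous := ⟨p, fun α _ _ => hp.mem_G⟩
    compat := fun α hbα hαd => by
      have h1 := (Submodule.mem_bot _).1 (hp.z_succ_add_mem hbα (hαd.trans_le hdm))
      rwa [← ZModModule.sub_eq_add, sub_eq_zero] at h1
    birth := by
      rintro j rfl
      exact hp.notMem_of_fwd ((F.boundaryPairs_birthAt hw).1 hp.birthAt.2).1
    death := fun hd => by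
      have h1 := h.dies b hbD hbm hd
      have h2 := ((F.boundaryPairs_deathAt hw).1 (h1.imp And.left And.left)).1
      exact h1.of_not_fwd hd h2 }

end Births

end Filtration

end WireZigzag

end

/-! ### The main theorem. -/

theorem mainTheorem1 {V : Type*} {m : ℕ} (F : WireZigzag.Filtration V m) :
    ∃ w : ℕ → WireZigzag.Chain V,
      (∀ i ∈ F.homologyBirths ∪ F.boundaryBirths, F.IsWire i (w i)) ∧
      (∃ SH : Multiset (ℕ × ℕ),
        (∀ T, F.homologyModule.IsBarcode T ↔ T = SH) ∧
        SH.map Prod.fst = F.homologyBirths.val ∧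
        SH.map Prod.snd = F.homologyDeaths ∧
        ∀ I ∈ SH, ∃ J ⊆ F.homologyBirths ∪ F.boundaryBirths,
          F.IsHomologyRep I.1 I.2 (WireZigzag.bundleSum w J)) ∧
      (∃ SB : Multiset (ℕ × ℕ),
        (∀ T, F.boundaryModule.IsBarcode T ↔ T = SB) ∧
        SB.map Prod.fst = F.boundaryBirths.val ∧
        SB.map Prod.snd = F.boundaryDeaths ∧
        ∀ I ∈ SB, ∃ J ⊆ F.homologyBirths ∪ F.boundaryBirths,
          F.IsBoundaryRep I.1 I.2 (WireZigzag.bundleSum w J)) := by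
  classical
  have hex : ∀ i, ∃ x, i < m → F.WireChoice i x := fun i => by
    by_cases hi : i < m
    · obtain ⟨x, hx⟩ := F.exists_wireChoice hi
      exact ⟨x, fun _ => hx⟩
    · exact ⟨0, fun h => absurd h hi⟩
  choose w₀ hw₀ using hex
  -- Wires are indexed by the index after the arrow. The same `w` feeds both pair zigzags, which is
  -- what makes the family common to homology and boundaries.
  let w : ℕ → WireZigzag.Chain V := fun j => w₀ (j - 1)
  have hw : ∀ i < m, F.WireChoice i (w (i + 1)) := hw₀
  obtain ⟨d, J, h⟩ := (F.homologyPairs w hw).exists_isState m le_rfl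
  obtain ⟨d', J', h'⟩ := (F.boundaryPairs w hw).exists_isState m le_rfl
  have hdeath : F.homologyBirths.val.map d = F.homologyDeaths := by
    rw [F.homologyBirths_eq hw, h.map_death (F.homologyPairs_presents hw),
      F.homologyDeaths_eq hw]
    rfl
  have hdeath' : F.boundaryBirths.val.map d' = F.boundaryDeaths := by
    rw [F.boundaryBirths_eq hw, h'.map_death (F.boundaryPairs_presents hw),
      F.boundaryDeaths_eq hw]
    rfl
  refine ⟨w, fun i hi => F.isWire hw hi, ⟨F.homologyBirths.val.map fun b => (b, d b), ?_, ?_, ?_,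
    ?_⟩, ⟨F.boundaryBirths.val.map fun b => (b, d' b), ?_, ?_, ?_, ?_⟩⟩
  · have h1 := h.isBarcode (F.homologyPairs_presents hw)
    rw [← F.homologyBirths_eq hw] at h1
    exact fun T => ⟨fun hT => hT.unique h1, fun hT => hT ▸ h1⟩
  · rw [Multiset.map_map]
    exact Multiset.map_id _
  · rw [Multiset.map_map]
    exact hdeath
  · intro I hI
    obtain ⟨b, hb, rfl⟩ := Multiset.mem_map.1 hI
    have hbD : b ∈ (F.homologyPairs w hw).births := F.homologyBirths_eq hw ▸ hb
    obtain ⟨j, hj, -, hjb⟩ := (WireZigzag.PairZigzag.mem_births _).1 hbD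
    obtain ⟨p, hp⟩ := h.bar b hbD (by omega)
    refine ⟨J b, ?_, WireZigzag.Filtration.isHomologyRep h hb
      (hdeath ▸ Multiset.mem_map_of_mem d hb)⟩
    rw [F.homologyBirths_eq hw]
    exact hp.subset.trans Finset.subset_union_left
  · have h1 := h'.isBarcode (F.boundaryPairs_presents hw)
    rw [← F.boundaryBirths_eq hw] at h1
    exact fun T => ⟨fun hT => hT.unique h1, fun hT => hT ▸ h1⟩
  · rw [Multiset.map_map]
    exact Multiset.map_id _
  · rw [Multiset.map_map]
    exact hdeath'
  · intro I hI
    obtain ⟨b, hb, rfl⟩ := Multiset.mem_map.1 hI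
    have hbD : b ∈ (F.boundaryPairs w hw).births := F.boundaryBirths_eq hw ▸ hb
    obtain ⟨j, hj, -, hjb⟩ := (WireZigzag.PairZigzag.mem_births _).1 hbD
    obtain ⟨p, hp⟩ := h'.bar b hbD (by omega)
    refine ⟨J' b, ?_, WireZigzag.Filtration.isBoundaryRep h' hb
      (hdeath' ▸ Multiset.mem_map_of_mem d' hb)⟩
    rw [F.boundaryBirths_eq hw]
    exact hp.subset.trans Finset.subset_union_right
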